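/- Let $(V,E)$ be a Bratteli diagram: $V=\bigsqcup_{n\ge 0}V_n$ and $E=\bigsqcup_{n\ge 0}E_n$ with all $V_n$, $E_n$ finite and non-empty, $V_0$ a single vertex, every edge $e\in E_n$ having an initial vertex $i(e)\in V_n$ and a terminal vertex $t(e)\in V_{n+1}$, with no sinks and with no sources outside $V_0$. For $n\ge 1$ let $E_n$ carry a partial order in which two edges are comparable if and only if they have the same terminal vertex. Assume that the ordered diagram is stationary: for some $N$, the vertices of each $V_n$, $n\ge1$, are labelled bijectively by $\{1,\dots,N\}$, and for each $n\ge 1$ there is an order isomorphism $E_n\cong E_1$ that preserves the labels of the initial and the terminal vertices. No further hypothesis is made; the diagram need not be simple or well ordered. Let $X=\{\xi\in\prod_{n\ge1}E_n : t(\xi_j)=i(\xi_{j+1})\text{ for all } j\ge 1\}$, a compact space in the product topology. Let $X_{\max}$ (respectively $X_{\min}$) be the set of the $\xi\in X$ all of whose edges are maximal (respectively minimal), and put $X_{-1}=X\setminus X_{\max}$, $X_1=X\setminus X_{\min}$. The Vershik map is the homeomorphism $\lambda:X_{-1}\to X_1$ that sends $\xi$, with $\xi_1,\dots,\xi_{n-1}$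 maximal and $\xi_n$ not maximal, to $g_1\cdots g_n\xi_{n+1}\xi_{n+2}\cdots\in X$, where $g_n$ is the successor of $\xi_n$ and $g_1,\dots,g_{n-1}$ are minimal. For $n\in\mathbb Z$ let $\theta_n=\lambda^n$, a homeomorphism from its natural domain $X_{-n}$ (the open set of the points where the $n$-th power is defined) onto $X_n$. This is a partial action of $\mathbb Z$ on $X$; let $\alpha_n:C_0(X_{-n})\to C_0(X_n)$, $\alpha_n(f)=f\circ\theta_{-n}$, be the corresponding partial action on $C(X)$. Let $C(X)\rtimes_\alpha\mathbb Z$ be the partial crossed product, that is, the enveloping $C^*$-algebra of the $*$-algebra of the finite sums $\sum_n a_n\delta_n$ with $a_n\in C_0(X_n)$, with the product $(a\delta_n)(b\delta_m)=\alpha_n(\alpha_{-n}(a)b)\delta_{n+m}$ and the involution $(a\delta_n)^*=\alpha_{-n}(a^*)\delta_{-n}$. Then $C(X)\rtimes_\alpha\mathbb Z$ is an AF algebra, that is, the closure of the union of an increasing sequence of finite-dimensional $C^*$-subalgebras. -/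

import Mathlib

open scoped Topology

universe u v

noncomputable section

/-! ### Partial actions of `ℤ` on a compact Hausdorff space -/

/-- A partial action of `ℤ` on `X`: homeomorphisms `θ n` from the open set `X₋ₙ` (the source of
`θ n`) onto the open set `Xₙ` (the target of `θ n`), such that `θ 0` is the identity of `X`,
`θ (-n)` is the inverse of `θ n`, and `θ (n + m)` extends `θ n ∘ θ m`. -/
structure PartialAction (X : Type u) [TopologicalSpace X] where
  map : ℤ → OpenPartialHomeomorph X X
  map_zero : map 0 = OpenPartialHomeomorph.refl X
  map_neg : ∀ n, map (-n) = (map n).symm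
  map_add_source : ∀ n m x, x ∈ (map m).source → map m x ∈ (map n).source →
    x ∈ (map (n + m)).source
  map_add_apply : ∀ n m x, x ∈ (map m).source → map m x ∈ (map n).source →
    map (n + m) x = map n (map m x)

section Pushforward

variable {X : Type u} [TopologicalSpace X] [CompactSpace X] [T2Space X]

open Classical in
/-- A function vanishing off the source of `e` is transported along `e` and extended by zero. -/
theorem continuous_pushforward (e : OpenPartialHomeomorph X X)
    (f : ContinuousMap.idealOfSet ℂ e.source) :
    Continuous fun x => if x ∈ e.target then (f : C(X, ℂ)) (e.symm x) else 0 := by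
  have hf : ∀ x, x ∉ e.source → (f : C(X, ℂ)) x = 0 := fun x hx =>
    ContinuousMap.mem_idealOfSet.mp f.2 hx
  rw [continuous_iff_continuousAt]
  intro x
  by_cases hx : x ∈ e.target
  · have h1 : ContinuousAt (fun x => (f : C(X, ℂ)) (e.symm x)) x :=
      (f : C(X, ℂ)).continuous.continuousAt.comp (e.continuousAt_symm hx)
    refine h1.congr ?_
    filter_upwards [e.open_target.mem_nhds hx] with y hy
    simp [hy]
  · rw [Metric.continuousAt_iff']
    intro ε hε
    have hK : IsCompact {y | ε ≤ ‖(f : C(X, ℂ)) y‖} :=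
      (isClosed_le continuous_const (f : C(X, ℂ)).continuous.norm).isCompact
    have hKs : {y | ε ≤ ‖(f : C(X, ℂ)) y‖} ⊆ e.source := by
      intro y hy
      by_contra h
      have : ε ≤ ‖(f : C(X, ℂ)) y‖ := hy
      rw [hf y h, norm_zero] at this
      exact absurd this (not_le.mpr hε)
    have hC : IsClosed (e '' {y | ε ≤ ‖(f : C(X, ℂ)) y‖}) :=
      (hK.image_of_continuousOn (e.continuousOn.mono hKs)).isClosed
    have hxC : x ∉ e '' {y | ε ≤ ‖(f : C(X, ℂ)) y‖} := by
      rintro ⟨y, hy, rfl⟩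
      exact hx (e.map_source (hKs hy))
    filter_upwards [hC.isOpen_compl.mem_nhds hxC] with y hy
    simp only [hx, if_false, dist_zero_right]
    split_ifs with h
    · by_contra hlt
      exact hy ⟨e.symm y, not_lt.mp hlt, e.right_inv h⟩
    · simpa using hε

open Classical in
/-- The isomorphism `C₀(source) → C₀(target)`, `f ↦ f ∘ e⁻¹`, induced by a homeomorphism `e`
between open subsets of `X`. Here `C₀(U)` is the ideal of all functions in `C(X)` that vanish
off `U`, so the formula `f ∘ e⁻¹` holds on the target of `e` and the value is `0` elsewhere. -/
def pushforward (e : OpenPartialHomeomorph X X) :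
    ContinuousMap.idealOfSet ℂ e.source →ₗ[ℂ] ContinuousMap.idealOfSet ℂ e.target where
  toFun f := ⟨⟨fun x => if x ∈ e.target then (f : C(X, ℂ)) (e.symm x) else 0,
    continuous_pushforward e f⟩, fun x hx => if_neg hx⟩
  map_add' f g := by
    ext x
    by_cases h : x ∈ e.target <;> simp [h]
  map_smul' c f := by
    ext x
    by_cases h : x ∈ e.target <;> simp [h]

theorem pushforward_apply (e : OpenPartialHomeomorph X X)
    (f : ContinuousMap.idealOfSet ℂ e.source) {x : X} (hx : x ∈ e.target) :
    (pushforward e f : C(X, ℂ)) x = (f : C(X, ℂ)) (e.symm x) :=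
  if_pos hx

end Pushforward

namespace PartialAction

variable {X : Type u} [TopologicalSpace X] (θ : PartialAction X)

theorem symm_mem_source {n : ℤ} {x : X} (hx : x ∈ (θ.map n).target) :
    (θ.map n).symm x ∈ (θ.map n).source := (θ.map n).map_target hx

theorem target_neg (n : ℤ) : (θ.map (-n)).target = (θ.map n).source := by
  rw [θ.map_neg]; rfl

theorem source_neg (n : ℤ) : (θ.map (-n)).source = (θ.map n).target := by
  rw [θ.map_neg]; rfl

theorem target_zero : (θ.map 0).target = Set.univ := by
  rw [θ.map_zero]; rfl

theorem symm_zero (x : X) : (θ.map 0).symm x = x := by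
  rw [θ.map_zero]; rfl

/-- If `x ∈ Xₙ` and `θ₋ₙ x ∈ Xₘ`, then `x ∈ Xₙ₊ₘ`. -/
theorem mem_target_add {n m : ℤ} {x : X} (hx : x ∈ (θ.map n).target)
    (hy : (θ.map n).symm x ∈ (θ.map m).target) : x ∈ (θ.map (n + m)).target := by
  rw [← θ.source_neg, neg_add_rev]
  refine θ.map_add_source _ _ _ ?_ ?_
  · rwa [θ.source_neg]
  · rw [θ.source_neg, θ.map_neg]; exact hy

theorem symm_add {n m : ℤ} {x : X} (hx : x ∈ (θ.map n).target)
    (hy : (θ.map n).symm x ∈ (θ.map m).target) :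
    (θ.map (n + m)).symm x = (θ.map m).symm ((θ.map n).symm x) := by
  have h := θ.map_add_apply (-m) (-n) x (by rwa [θ.source_neg])
    (by rw [θ.source_neg, θ.map_neg]; exact hy)
  rw [← neg_add_rev, θ.map_neg, θ.map_neg, θ.map_neg] at h
  exact h

/-- If `x ∈ Xₙ ∩ Xₙ₊ₘ`, then `θ₋ₙ x ∈ Xₘ`. -/
theorem symm_mem_target {n m : ℤ} {x : X} (hx : x ∈ (θ.map n).target)
    (hy : x ∈ (θ.map (n + m)).target) : (θ.map n).symm x ∈ (θ.map m).target := by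
  have h := θ.mem_target_add (n := -n) (m := n + m) (x := (θ.map n).symm x)
    (by rw [θ.target_neg]; exact θ.symm_mem_source hx)
    (by rw [θ.map_neg, OpenPartialHomeomorph.symm_symm, (θ.map n).right_inv hx]; exact hy)
  rwa [neg_add_cancel_left] at h

variable [CompactSpace X] [T2Space X]

/-- `C₀(Xₙ)`, the ideal of the functions in `C(X)` that vanish off `Xₙ`. -/
abbrev C₀ (n : ℤ) : Ideal C(X, ℂ) := ContinuousMap.idealOfSet ℂ (θ.map n).target

set_option linter.unusedSectionVars false in
theorem C₀_apply {n : ℤ} (f : θ.C₀ n) {x : X} (hx : x ∉ (θ.map n).target) :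
    (f : C(X, ℂ)) x = 0 := ContinuousMap.mem_idealOfSet.mp f.2 hx

/-- `α n : C₀(X₋ₙ) → C₀(Xₙ)`, `f ↦ f ∘ θ₋ₙ`. -/
def α (n : ℤ) : ContinuousMap.idealOfSet ℂ (θ.map n).source →ₗ[ℂ] θ.C₀ n :=
  pushforward (θ.map n)

/-- `α₋ₙ : C₀(Xₙ) → C₀(X₋ₙ)`, `f ↦ f ∘ θₙ`. -/
def αneg (n : ℤ) : θ.C₀ n →ₗ[ℂ] ContinuousMap.idealOfSet ℂ (θ.map n).source :=
  pushforward (θ.map n).symm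

theorem α_apply {n : ℤ} (f : ContinuousMap.idealOfSet ℂ (θ.map n).source) {x : X}
    (hx : x ∈ (θ.map n).target) : (θ.α n f : C(X, ℂ)) x = (f : C(X, ℂ)) ((θ.map n).symm x) :=
  pushforward_apply _ f hx

theorem αneg_apply {n : ℤ} (f : θ.C₀ n) {x : X} (hx : x ∈ (θ.map n).source) :
    (θ.αneg n f : C(X, ℂ)) x = (f : C(X, ℂ)) (θ.map n x) :=
  pushforward_apply (θ.map n).symm f hx

/-- The product on homogeneous elements: `(a δₙ) (b δₘ) = αₙ(α₋ₙ(a) b) δₙ₊ₘ`. -/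
def gmul {n m : ℤ} (a : θ.C₀ n) (b : θ.C₀ m) : θ.C₀ (n + m) :=
  ⟨θ.α n ⟨θ.αneg n a * (b : C(X, ℂ)), Ideal.mul_mem_right _ _ (θ.αneg n a).2⟩, by
    intro x hx
    by_cases h : x ∈ (θ.map n).target
    · rw [α_apply _ _ h]
      have : (θ.map n).symm x ∉ (θ.map m).target := fun h' => hx (θ.mem_target_add h h')
      simp [θ.C₀_apply b this]
    · exact θ.C₀_apply _ h⟩

theorem gmul_apply {n m : ℤ} (a : θ.C₀ n) (b : θ.C₀ m) (x : X) :
    (θ.gmul a b : C(X, ℂ)) x = (a : C(X, ℂ)) x * (b : C(X, ℂ)) ((θ.map n).symm x) := by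
  by_cases h : x ∈ (θ.map n).target
  · change (θ.α n _ : C(X, ℂ)) x = _
    rw [α_apply _ _ h]
    simp [αneg_apply _ _ (θ.symm_mem_source h), (θ.map n).right_inv h]
  · rw [θ.C₀_apply a h, zero_mul]
    exact θ.C₀_apply (θ.α n _) h

/-- The involution on homogeneous elements: `(a δₙ)* = α₋ₙ(a*) δ₋ₙ`. -/
def gstar {n : ℤ} (a : θ.C₀ n) : θ.C₀ (-n) :=
  ⟨θ.αneg n ⟨star (a : C(X, ℂ)), fun x hx => by simp [θ.C₀_apply a hx]⟩, by
    have h := (θ.αneg n ⟨star (a : C(X, ℂ)), fun x hx => by simp [θ.C₀_apply a hx]⟩).2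
    intro x hx
    rw [θ.target_neg] at hx
    exact ContinuousMap.mem_idealOfSet.mp h hx⟩

theorem gstar_apply {n : ℤ} (a : θ.C₀ n) {x : X} (hx : x ∈ (θ.map n).source) :
    (θ.gstar a : C(X, ℂ)) x = star ((a : C(X, ℂ)) (θ.map n x)) :=
  θ.αneg_apply _ hx

theorem gstar_apply_of_notMem {n : ℤ} (a : θ.C₀ n) {x : X} (hx : x ∉ (θ.map n).source) :
    (θ.gstar a : C(X, ℂ)) x = 0 :=
  θ.C₀_apply _ (by rwa [θ.target_neg])

set_option linter.unusedSectionVars false in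
theorem mk_eq_mk {n m : ℤ} (h : n = m) (a : θ.C₀ n) (b : θ.C₀ m)
    (hab : ∀ x, (a : C(X, ℂ)) x = (b : C(X, ℂ)) x) :
    GradedMonoid.mk (A := fun n => θ.C₀ n) n a = GradedMonoid.mk m b := by
  subst h
  congr 1
  ext x
  exact hab x

/-- An element of `C(X)` seen in `C₀(X₀)`; recall that `X₀ = X`. -/
def ofC (f : C(X, ℂ)) : θ.C₀ 0 :=
  ⟨f, fun x hx => absurd (θ.target_zero ▸ Set.mem_univ x) hx⟩

instance gmulInst : GradedMonoid.GMul (fun n : ℤ => θ.C₀ n) where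
  mul a b := θ.gmul a b

instance goneInst : GradedMonoid.GOne (fun n : ℤ => θ.C₀ n) where
  one := θ.ofC 1

instance gmonoid : GradedMonoid.GMonoid (fun n : ℤ => θ.C₀ n) where
  one_mul a := by
    refine θ.mk_eq_mk (zero_add _) _ _ fun x => ?_
    change (θ.gmul (θ.ofC 1) a.2 : C(X, ℂ)) x = _
    rw [gmul_apply, symm_zero]
    simp [ofC]
  mul_one a := by
    refine θ.mk_eq_mk (add_zero _) _ _ fun x => ?_
    change (θ.gmul a.2 (θ.ofC 1) : C(X, ℂ)) x = _
    rw [gmul_apply]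
    simp [ofC]
  mul_assoc a b c := by
    refine θ.mk_eq_mk (add_assoc _ _ _) _ _ fun x => ?_
    change (θ.gmul (θ.gmul a.2 b.2) c.2 : C(X, ℂ)) x = (θ.gmul a.2 (θ.gmul b.2 c.2) : C(X, ℂ)) x
    simp only [gmul_apply]
    by_cases h : x ∈ (θ.map a.1).target
    · by_cases h' : (θ.map a.1).symm x ∈ (θ.map b.1).target
      · rw [θ.symm_add h h', mul_assoc]
      · rw [θ.C₀_apply b.2 h']; simp
    · rw [θ.C₀_apply a.2 h]; simp

instance gring : DirectSum.GRing (fun n : ℤ => θ.C₀ n) where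
  __ := θ.gmonoid
  mul_zero a := by
    ext x
    change (θ.gmul a 0 : C(X, ℂ)) x = 0
    simp [gmul_apply]
  zero_mul b := by
    ext x
    change (θ.gmul 0 b : C(X, ℂ)) x = 0
    simp [gmul_apply]
  mul_add a b c := by
    ext x
    change (θ.gmul a (b + c) : C(X, ℂ)) x = (θ.gmul a b : C(X, ℂ)) x + (θ.gmul a c : C(X, ℂ)) x
    simp [gmul_apply, mul_add]
  add_mul a b c := by
    ext x
    change (θ.gmul (a + b) c : C(X, ℂ)) x = (θ.gmul a c : C(X, ℂ)) x + (θ.gmul b c : C(X, ℂ)) x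
    simp [gmul_apply, add_mul]
  natCast k := θ.ofC k
  natCast_zero := by ext x; simp [ofC]
  natCast_succ k := by ext x; simp [ofC, GradedMonoid.GOne.one]
  intCast k := θ.ofC k
  intCast_ofNat k := by ext x; simp [ofC]
  intCast_negSucc_ofNat k := by ext x; simp [ofC]

instance galgebra : DirectSum.GAlgebra ℂ (fun n : ℤ => θ.C₀ n) where
  toFun := { toFun := fun c => θ.ofC (algebraMap ℂ C(X, ℂ) c)
             map_zero' := by ext x; simp [ofC]
             map_add' := fun a b => by ext x; simp [ofC] }
  map_one := by ext x; simp [ofC, GradedMonoid.GOne.one]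
  map_mul r s := by
    refine θ.mk_eq_mk (zero_add _).symm _ _ fun x => ?_
    change _ = (θ.gmul _ _ : C(X, ℂ)) x
    rw [gmul_apply]
    simp [ofC]
  commutes r a := by
    refine θ.mk_eq_mk (add_comm _ _) _ _ fun x => ?_
    change (θ.gmul (θ.ofC (algebraMap ℂ C(X, ℂ) r)) a.2 : C(X, ℂ)) x =
      (θ.gmul a.2 (θ.ofC (algebraMap ℂ C(X, ℂ) r)) : C(X, ℂ)) x
    rw [gmul_apply, gmul_apply, symm_zero]
    simp [ofC, mul_comm]
  smul_def r a := by
    refine θ.mk_eq_mk (zero_add _).symm _ _ fun x => ?_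
    change _ = (θ.gmul (θ.ofC (algebraMap ℂ C(X, ℂ) r)) a.2 : C(X, ℂ)) x
    rw [gmul_apply, symm_zero]
    simp [ofC]

/-- The algebraic partial crossed product: the `*`-algebra of the finite formal sums
`∑ aₙ δₙ` with `aₙ ∈ C₀(Xₙ)`. -/
def AlgCrossedProduct : Type u := DirectSum ℤ fun n => θ.C₀ n

namespace AlgCrossedProduct

instance : Ring θ.AlgCrossedProduct := inferInstanceAs (Ring (DirectSum ℤ fun n => θ.C₀ n))

instance : Algebra ℂ θ.AlgCrossedProduct :=
  inferInstanceAs (Algebra ℂ (DirectSum ℤ fun n => θ.C₀ n))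

/-- The element `a δₙ`. -/
def δ (n : ℤ) : θ.C₀ n →ₗ[ℂ] θ.AlgCrossedProduct :=
  DirectSum.lof ℂ ℤ (fun n => θ.C₀ n) n

theorem δ_mul_δ {n m : ℤ} (a : θ.C₀ n) (b : θ.C₀ m) :
    δ θ n a * δ θ m b = δ θ (n + m) (θ.gmul a b) :=
  DirectSum.of_mul_of (A := fun n : ℤ => θ.C₀ n) a b

theorem δ_congr {n m : ℤ} (h : n = m) (a : θ.C₀ n) (b : θ.C₀ m)
    (hab : ∀ x, (a : C(X, ℂ)) x = (b : C(X, ℂ)) x) : δ θ n a = δ θ m b :=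
  DirectSum.of_eq_of_gradedMonoid_eq (θ.mk_eq_mk h a b hab)

theorem induction {p : θ.AlgCrossedProduct → Prop} (zero : p 0) (δ : ∀ n a, p (δ θ n a))
    (add : ∀ a b, p a → p b → p (a + b)) (a : θ.AlgCrossedProduct) : p a :=
  DirectSum.induction_on (β := fun n : ℤ => θ.C₀ n) a zero δ add

theorem addHom_ext {M : Type*} [AddCommMonoid M] {f g : θ.AlgCrossedProduct →+ M}
    (h : ∀ n a, f (δ θ n a) = g (δ θ n a)) : f = g :=
  DirectSum.addHom_ext (β := fun n : ℤ => θ.C₀ n) h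

/-- The involution: `(∑ aₙ δₙ)* = ∑ α₋ₙ(aₙ*) δ₋ₙ`. -/
def starHom : θ.AlgCrossedProduct →+ θ.AlgCrossedProduct :=
  DirectSum.toAddMonoid (β := fun n : ℤ => θ.C₀ n) fun n =>
    { toFun := fun a => δ θ (-n) (θ.gstar a)
      map_zero' := by
        rw [← _root_.map_zero (δ θ (-n))]
        refine δ_congr θ rfl _ _ fun x => ?_
        by_cases h : x ∈ (θ.map n).source
        · simp [gstar_apply _ _ h]
        · simp [gstar_apply_of_notMem _ _ h]
      map_add' := fun a b => by
        rw [← map_add]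
        refine δ_congr θ rfl _ _ fun x => ?_
        by_cases h : x ∈ (θ.map n).source
        · simp [gstar_apply _ _ h]
        · simp [gstar_apply_of_notMem _ _ h] }

theorem starHom_δ {n : ℤ} (a : θ.C₀ n) : starHom θ (δ θ n a) = δ θ (-n) (θ.gstar a) :=
  DirectSum.toAddMonoid_of (β := fun n : ℤ => θ.C₀ n) _ n a

theorem gstar_gmul_apply {n m : ℤ} (a : θ.C₀ n) (b : θ.C₀ m) (x : X) :
    (θ.gstar (θ.gmul a b) : C(X, ℂ)) x = (θ.gmul (θ.gstar b) (θ.gstar a) : C(X, ℂ)) x := by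
  rw [gmul_apply, θ.map_neg, OpenPartialHomeomorph.symm_symm]
  by_cases hm : x ∈ (θ.map m).source
  · have hm' : x ∈ (θ.map (-m)).target := by rwa [θ.target_neg]
    rw [gstar_apply _ b hm]
    by_cases hn : θ.map m x ∈ (θ.map n).source
    · have hnm := θ.map_add_source _ _ _ hm hn
      rw [gstar_apply _ a hn, gstar_apply _ _ hnm, gmul_apply, θ.map_add_apply _ _ _ hm hn,
        (θ.map n).left_inv hn, star_mul]
    · rw [gstar_apply_of_notMem _ a hn, mul_zero]
      by_cases hnm : x ∈ (θ.map (n + m)).source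
      · exfalso
        apply hn
        have h := θ.symm_mem_target (n := -m) (m := -n) (x := x) hm'
          (by rw [← neg_add_rev, θ.target_neg]; exact hnm)
        rwa [θ.target_neg, θ.map_neg] at h
      · rw [gstar_apply_of_notMem _ _ hnm]
  · rw [gstar_apply_of_notMem _ b hm, zero_mul]
    by_cases hnm : x ∈ (θ.map (n + m)).source
    · rw [gstar_apply _ _ hnm, gmul_apply]
      by_cases hn : θ.map (n + m) x ∈ (θ.map n).target
      · rw [θ.C₀_apply b, mul_zero, star_zero]
        intro hb
        apply hm
        have h1 := θ.symm_mem_source hb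
        have h2 := θ.symm_add hn hb
        rw [← h2, (θ.map (n + m)).left_inv hnm] at h1
        exact h1
      · rw [θ.C₀_apply a hn, zero_mul, star_zero]
    · rw [gstar_apply_of_notMem _ _ hnm]

instance : StarRing θ.AlgCrossedProduct where
  star := starHom θ
  star_involutive a := by
    have h : (starHom θ).comp (starHom θ) = AddMonoidHom.id _ := by
      refine addHom_ext θ fun n a => ?_
      rw [AddMonoidHom.comp_apply, starHom_δ, starHom_δ, AddMonoidHom.id_apply]
      refine δ_congr θ (neg_neg n) _ _ fun x => ?_
      by_cases hx : x ∈ (θ.map n).target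
      · rw [gstar_apply _ _ (by rwa [θ.source_neg]), gstar_apply, θ.map_neg, star_star,
          (θ.map n).right_inv hx]
        rw [θ.map_neg]
        exact θ.symm_mem_source hx
      · rw [gstar_apply_of_notMem _ _ (by rwa [θ.source_neg]), θ.C₀_apply a hx]
    exact DFunLike.congr_fun h a
  star_add a b := _root_.map_add (starHom θ) a b
  star_mul a b := by
    change starHom θ (a * b) = starHom θ b * starHom θ a
    induction a using induction with
    | zero => simp
    | add a₁ a₂ h₁ h₂ => rw [add_mul, map_add, map_add, mul_add, h₁, h₂]
    | δ n a =>
      induction b using induction with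
      | zero => simp
      | add b₁ b₂ h₁ h₂ => rw [mul_add, map_add, map_add, add_mul, h₁, h₂]
      | δ m b =>
        rw [starHom_δ, starHom_δ, δ_mul_δ, δ_mul_δ, starHom_δ]
        exact δ_congr θ (neg_add_rev n m) _ _ (gstar_gmul_apply θ a b)

theorem star_δ {n : ℤ} (a : θ.C₀ n) : star (δ θ n a) = δ θ (-n) (θ.gstar a) :=
  starHom_δ θ a

instance : StarModule ℂ θ.AlgCrossedProduct where
  star_smul c a := by
    induction a using induction with
    | zero => simp
    | add a b ha hb => rw [smul_add, star_add, star_add, smul_add, ha, hb]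
    | δ n a =>
      rw [← map_smul, star_δ, star_δ, ← map_smul]
      refine δ_congr θ rfl _ _ fun x => ?_
      by_cases h : x ∈ (θ.map n).source
      · simp [gstar_apply _ _ h]
      · simp [gstar_apply_of_notMem _ _ h]

/-- The set of all `‖π a‖`, where `π` runs over the `*`-homomorphisms from the algebraic partial
crossed product to C⋆-algebras. -/
def normSet (a : θ.AlgCrossedProduct) : Set ℝ :=
  {r | ∃ (B : Type u) (_ : NonUnitalCStarAlgebra B) (π : θ.AlgCrossedProduct →⋆ₙₐ[ℂ] B),
    r = ‖π a‖}

/-- The canonical `*`-homomorphism `C(X) → C(X) ⋊ ℤ`, `f ↦ f δ₀`. -/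
def ofCHom : C(X, ℂ) →⋆ₙₐ[ℂ] θ.AlgCrossedProduct where
  toFun f := δ θ 0 (θ.ofC f)
  map_smul' c f := (_root_.map_smul (δ θ 0) c (θ.ofC f))
  map_zero' := _root_.map_zero (δ θ 0)
  map_add' f g := _root_.map_add (δ θ 0) (θ.ofC f) (θ.ofC g)
  map_mul' f g := by
    rw [δ_mul_δ]
    refine δ_congr θ (zero_add _).symm _ _ fun x => ?_
    rw [gmul_apply, symm_zero]
    rfl
  map_star' f := by
    rw [star_δ]
    refine δ_congr θ neg_zero.symm _ _ fun x => ?_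
    rw [gstar_apply]
    · rw [θ.map_zero]; rfl
    · rw [θ.map_zero]; trivial

theorem norm_apply_δ_le {B : Type u} [NonUnitalCStarAlgebra B]
    (π : θ.AlgCrossedProduct →⋆ₙₐ[ℂ] B) (n : ℤ) (a : θ.C₀ n) :
    ‖π (δ θ n a)‖ ≤ ‖(a : C(X, ℂ))‖ := by
  have h1 : δ θ n a * star (δ θ n a) = ofCHom θ (a * star (a : C(X, ℂ))) := by
    rw [star_δ, δ_mul_δ]
    refine δ_congr θ (add_neg_cancel n) _ _ fun x => ?_
    rw [gmul_apply]
    by_cases hx : x ∈ (θ.map n).target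
    · rw [gstar_apply _ _ (θ.symm_mem_source hx), (θ.map n).right_inv hx]
      rfl
    · rw [θ.C₀_apply a hx]
      simp [ofC, θ.C₀_apply a hx]
  have h2 : ‖π (δ θ n a)‖ * ‖π (δ θ n a)‖ ≤ ‖(a : C(X, ℂ))‖ * ‖(a : C(X, ℂ))‖ := by
    rw [← CStarRing.norm_self_mul_star, ← map_star, ← map_mul, h1,
      ← CStarRing.norm_self_mul_star]
    exact NonUnitalStarAlgHom.norm_apply_le (π.comp (ofCHom θ)) _
  exact abs_le_of_sq_le_sq' (by nlinarith) (norm_nonneg _) |>.2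

theorem bddAbove_normSet (a : θ.AlgCrossedProduct) : BddAbove (normSet θ a) := by
  induction a using induction with
  | zero =>
    refine ⟨0, ?_⟩
    rintro r ⟨B, _, π, rfl⟩
    simp
  | δ n a =>
    refine ⟨‖(a : C(X, ℂ))‖, ?_⟩
    rintro r ⟨B, _, π, rfl⟩
    exact norm_apply_δ_le θ π n a
  | add a b ha hb =>
    obtain ⟨c, hc⟩ := ha
    obtain ⟨d, hd⟩ := hb
    refine ⟨c + d, ?_⟩
    rintro r ⟨B, _, π, rfl⟩
    rw [map_add]
    exact (norm_add_le _ _).trans (add_le_add (hc ⟨B, _, π, rfl⟩) (hd ⟨B, _, π, rfl⟩))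

theorem normSet_nonempty (a : θ.AlgCrossedProduct) : (normSet θ a).Nonempty :=
  ⟨_, C(X, ℂ), (inferInstance : NonUnitalCStarAlgebra C(X, ℂ)), 0, rfl⟩

/-- The greatest C⋆-seminorm: `‖a‖` is the supremum of `‖π a‖` over all `*`-homomorphisms `π`
from the algebraic partial crossed product to C⋆-algebras. -/
instance : Norm θ.AlgCrossedProduct := ⟨fun a => sSup (normSet θ a)⟩

theorem norm_apply_le {B : Type u} [NonUnitalCStarAlgebra B]
    (π : θ.AlgCrossedProduct →⋆ₙₐ[ℂ] B) (a : θ.AlgCrossedProduct) : ‖π a‖ ≤ ‖a‖ :=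
  le_csSup (bddAbove_normSet θ a) ⟨B, _, π, rfl⟩

theorem norm_le {a : θ.AlgCrossedProduct} {c : ℝ}
    (h : ∀ (B : Type u) (_ : NonUnitalCStarAlgebra B) (π : θ.AlgCrossedProduct →⋆ₙₐ[ℂ] B),
      ‖π a‖ ≤ c) : ‖a‖ ≤ c := by
  refine csSup_le (normSet_nonempty θ a) ?_
  rintro r ⟨B, _, π, rfl⟩
  exact h B _ π

theorem norm_nonneg' (a : θ.AlgCrossedProduct) : 0 ≤ ‖a‖ := by
  obtain ⟨r, B, _, π, rfl⟩ := normSet_nonempty θ a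
  exact (norm_nonneg _).trans (norm_apply_le θ π a)

instance : SeminormedRing θ.AlgCrossedProduct :=
  { AddGroupSeminorm.toSeminormedAddCommGroup
      { toFun := fun a : θ.AlgCrossedProduct => ‖a‖
        map_zero' := le_antisymm (norm_le θ fun B _ π => by simp) (norm_nonneg' θ 0)
        add_le' := fun a b => norm_le θ fun B _ π => by
          rw [map_add]
          exact (norm_add_le _ _).trans (add_le_add (norm_apply_le θ π a) (norm_apply_le θ π b))
        neg' := fun a => by
          refine le_antisymm (norm_le θ fun B _ π => ?_) (norm_le θ fun B _ π => ?_)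
          · rw [_root_.map_neg, norm_neg]; exact norm_apply_le θ π a
          · rw [← norm_neg, ← _root_.map_neg]; exact norm_apply_le θ π (-a) },
    (inferInstance : Ring θ.AlgCrossedProduct) with
    norm_mul_le := fun a b => norm_le θ fun B _ π => by
      rw [map_mul]
      exact (norm_mul_le _ _).trans (mul_le_mul (norm_apply_le θ π a) (norm_apply_le θ π b)
        (norm_nonneg _) (norm_nonneg' θ a)) }

instance : NormedAlgebra ℂ θ.AlgCrossedProduct where
  norm_smul_le c a := norm_le θ fun B _ π => by
    rw [map_smul, norm_smul]
    exact mul_le_mul_of_nonneg_left (norm_apply_le θ π a) (norm_nonneg c)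

theorem norm_star' (a : θ.AlgCrossedProduct) : ‖star a‖ = ‖a‖ := by
  have h : ∀ a : θ.AlgCrossedProduct, ‖star a‖ ≤ ‖a‖ := fun a => norm_le θ fun B _ π => by
    rw [map_star, norm_star]
    exact norm_apply_le θ π a
  refine le_antisymm (h a) ?_
  simpa using h (star a)

theorem norm_mul_self_le' (a : θ.AlgCrossedProduct) : ‖a‖ * ‖a‖ ≤ ‖star a * a‖ := by
  rw [← sq, ← Real.le_sqrt (norm_nonneg' θ a)]
  · refine norm_le θ fun B _ π => Real.le_sqrt_of_sq_le ?_
    rw [sq, ← CStarRing.norm_star_mul_self, ← map_star, ← map_mul]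
    exact norm_apply_le θ π _
  · exact norm_nonneg' θ _

end AlgCrossedProduct

/-- The partial crossed product `C(X) ⋊ ℤ`: the completion of the algebraic partial crossed
product for the greatest C⋆-seminorm (the completion is Hausdorff, so that elements of seminorm
zero become zero), that is, its enveloping C⋆-algebra. -/
def CrossedProduct : Type u := UniformSpace.Completion θ.AlgCrossedProduct

namespace CrossedProduct

open UniformSpace

instance : NormedRing θ.CrossedProduct :=
  inferInstanceAs (NormedRing (Completion θ.AlgCrossedProduct))

instance : CompleteSpace θ.CrossedProduct :=
  inferInstanceAs (CompleteSpace (Completion θ.AlgCrossedProduct))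

instance : Algebra ℂ θ.CrossedProduct :=
  inferInstanceAs (Algebra ℂ (Completion θ.AlgCrossedProduct))

instance : NormedAlgebra ℂ θ.CrossedProduct where
  norm_smul_le := norm_smul_le (α := ℂ) (β := Completion θ.AlgCrossedProduct)

/-- The canonical map from the algebraic partial crossed product. -/
def of (a : θ.AlgCrossedProduct) : θ.CrossedProduct := (a : Completion θ.AlgCrossedProduct)

theorem of_mul (a b : θ.AlgCrossedProduct) : of θ (a * b) = of θ a * of θ b := Completion.coe_mul a b

theorem of_add (a b : θ.AlgCrossedProduct) : of θ (a + b) = of θ a + of θ b := Completion.coe_add a b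

theorem of_smul (c : ℂ) (a : θ.AlgCrossedProduct) : of θ (c • a) = c • of θ a :=
  Completion.coe_smul c a

theorem norm_of (a : θ.AlgCrossedProduct) : ‖of θ a‖ = ‖a‖ := Completion.norm_coe a

theorem continuous_of : Continuous (of θ) := Completion.continuous_coe _

theorem denseRange_of : DenseRange (of θ) := Completion.denseRange_coe

theorem uniformContinuous_star : UniformContinuous (star : θ.AlgCrossedProduct → _) :=
  (AddMonoidHomClass.isometry_of_norm (AlgCrossedProduct.starHom θ)
    (AlgCrossedProduct.norm_star' θ)).uniformContinuous

instance : Star θ.CrossedProduct :=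
  ⟨Completion.map (star : θ.AlgCrossedProduct → θ.AlgCrossedProduct)⟩

theorem of_star (a : θ.AlgCrossedProduct) : of θ (star a) = star (of θ a) :=
  (Completion.map_coe (uniformContinuous_star θ) a).symm

theorem continuous_star' : Continuous (star : θ.CrossedProduct → _) := Completion.continuous_map

instance : CStarAlgebra θ.CrossedProduct where
  star_involutive a := by
    refine (denseRange_of θ).induction_on a (isClosed_eq
      ((continuous_star' θ).comp (continuous_star' θ)) continuous_id) fun a => ?_
    rw [← of_star, ← of_star, star_star]
  star_mul a b := by
    refine (denseRange_of θ).induction_on₂ (isClosed_eq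
      ((continuous_star' θ).comp continuous_mul)
      (((continuous_star' θ).comp continuous_snd).mul
        ((continuous_star' θ).comp continuous_fst))) (fun a b => ?_) a b
    rw [← of_star, ← of_star, ← of_mul, ← of_mul, ← of_star, star_mul]
  star_add a b := by
    refine (denseRange_of θ).induction_on₂ (isClosed_eq
      ((continuous_star' θ).comp continuous_add)
      (((continuous_star' θ).comp continuous_fst).add
        ((continuous_star' θ).comp continuous_snd))) (fun a b => ?_) a b
    rw [← of_star, ← of_star, ← of_add, ← of_add, ← of_star, star_add]
  star_smul c a := by
    refine (denseRange_of θ).induction_on a (isClosed_eq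
      ((continuous_star' θ).comp (continuous_const_smul c))
      ((continuous_star' θ).const_smul (star c))) fun a => ?_
    rw [← of_star, ← of_smul, ← of_smul, ← of_star, star_smul]
  norm_mul_self_le a := by
    refine (denseRange_of θ).induction_on a (isClosed_le
      (continuous_norm.mul continuous_norm)
      (((continuous_star' θ).mul continuous_id).norm)) fun a => ?_
    rw [← of_star, ← of_mul, norm_of, norm_of]
    exact AlgCrossedProduct.norm_mul_self_le' θ a

end CrossedProduct

end PartialAction

/-! ### The partial action generated by a partial homeomorphism -/

section Powers

variable {X : Type u} [TopologicalSpace X] (e : OpenPartialHomeomorph X X)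

/-- The `k`-fold composition of `e`, defined wherever all the steps are defined. -/
def iterPower : ℕ → OpenPartialHomeomorph X X
  | 0 => OpenPartialHomeomorph.refl X
  | k + 1 => (iterPower k).trans e

/-- The power `e ^ n` with `n ∈ ℤ`, defined wherever all the steps are defined. -/
def intPower : ℤ → OpenPartialHomeomorph X X
  | .ofNat k => iterPower e k
  | .negSucc k => (iterPower e (k + 1)).symm

theorem iterPower_succ' (k : ℕ) : iterPower e (k + 1) = e.trans (iterPower e k) := by
  induction k with
  | zero => simp [iterPower]
  | succ k ih =>
    change (iterPower e (k + 1)).trans e = e.trans ((iterPower e k).trans e)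
    rw [ih, OpenPartialHomeomorph.trans_assoc]

theorem intPower_natCast (k : ℕ) : intPower e (k : ℤ) = iterPower e k := rfl

theorem intPower_neg_natCast (k : ℕ) : intPower e (-(k : ℤ)) = (iterPower e k).symm := by
  cases k with
  | zero => rfl
  | succ k => rfl

theorem intPower_neg (n : ℤ) : intPower e (-n) = (intPower e n).symm := by
  obtain ⟨k, rfl | rfl⟩ := n.eq_nat_or_neg
  · exact intPower_neg_natCast e k
  · rw [neg_neg, intPower_neg_natCast, OpenPartialHomeomorph.symm_symm, intPower_natCast]

theorem intPower_step {m : ℤ} {x : X} (hx : x ∈ (intPower e m).source)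
    (hy : intPower e m x ∈ e.source) :
    x ∈ (intPower e (m + 1)).source ∧ intPower e (m + 1) x = e (intPower e m x) := by
  obtain ⟨k, rfl | rfl⟩ := m.eq_nat_or_neg
  · rw [intPower_natCast] at hx hy
    change x ∈ ((iterPower e k).trans e).source ∧ ((iterPower e k).trans e) x = _
    exact ⟨by rw [OpenPartialHomeomorph.trans_source]; exact ⟨hx, hy⟩, rfl⟩
  · cases k with
    | zero =>
      exact ⟨by
        change x ∈ ((OpenPartialHomeomorph.refl X).trans e).source
        rw [OpenPartialHomeomorph.trans_source]; exact ⟨hx, hy⟩, rfl⟩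
    | succ k =>
      have h1 : (-((k + 1 : ℕ) : ℤ) + 1) = -(k : ℤ) := by push_cast; ring
      rw [h1]
      rw [intPower_neg_natCast] at hx hy ⊢
      rw [intPower_neg_natCast]
      set y := (iterPower e (k + 1)).symm x with hydef
      have hys : y ∈ (iterPower e (k + 1)).source := (iterPower e (k + 1)).map_target hx
      have hyx : iterPower e (k + 1) y = x := (iterPower e (k + 1)).right_inv hx
      rw [iterPower_succ'] at hys hyx
      rw [OpenPartialHomeomorph.trans_source] at hys
      have hz : e y ∈ (iterPower e k).source := hys.2
      have hzx : iterPower e k (e y) = x := hyx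
      refine ⟨?_, ?_⟩
      · rw [← hzx]; exact (iterPower e k).map_source hz
      · rw [← hzx]; exact (iterPower e k).left_inv hz

theorem iterPower_symm (k : ℕ) : iterPower e.symm k = (iterPower e k).symm := by
  induction k with
  | zero => rfl
  | succ k ih =>
    rw [iterPower_succ' e]
    change (iterPower e.symm k).trans e.symm = _
    rw [ih, OpenPartialHomeomorph.trans_symm_eq_symm_trans_symm]

theorem intPower_symm (n : ℤ) : intPower e.symm n = intPower e (-n) := by
  obtain ⟨k, rfl | rfl⟩ := n.eq_nat_or_neg
  · rw [intPower_neg_natCast, intPower_natCast, iterPower_symm]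
  · rw [neg_neg, intPower_neg_natCast, iterPower_symm, OpenPartialHomeomorph.symm_symm,
      intPower_natCast]

theorem intPower_add_natCast (k : ℕ) {m : ℤ} {x : X} (hx : x ∈ (intPower e m).source)
    (hy : intPower e m x ∈ (iterPower e k).source) :
    x ∈ (intPower e (k + m)).source ∧
      intPower e (k + m) x = iterPower e k (intPower e m x) := by
  induction k with
  | zero => simpa using ⟨hx, rfl⟩
  | succ k ih =>
    change _ ∈ ((iterPower e k).trans e).source at hy
    rw [OpenPartialHomeomorph.trans_source] at hy
    obtain ⟨h1, h2⟩ := ih hy.1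
    have h3 := intPower_step e h1 (by rw [h2]; exact hy.2)
    have h4 : ((k + 1 : ℕ) : ℤ) + m = k + m + 1 := by push_cast; ring
    rw [h4]
    refine ⟨h3.1, ?_⟩
    rw [h3.2, h2]
    rfl

theorem intPower_add (n m : ℤ) {x : X} (hx : x ∈ (intPower e m).source)
    (hy : intPower e m x ∈ (intPower e n).source) :
    x ∈ (intPower e (n + m)).source ∧
      intPower e (n + m) x = intPower e n (intPower e m x) := by
  obtain ⟨k, rfl | rfl⟩ := n.eq_nat_or_neg
  · exact intPower_add_natCast e k hx hy
  · have hm : intPower e m = intPower e.symm (-m) := by rw [intPower_symm, neg_neg]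
    have hs : -(k : ℤ) + m = -(k + -m) := by ring
    rw [intPower_neg_natCast, ← iterPower_symm, hm] at hy
    rw [hm] at hx
    rw [hs, ← intPower_symm, hm, intPower_neg_natCast, ← iterPower_symm]
    exact intPower_add_natCast e.symm k hx hy

/-- The partial action of `ℤ` generated by a homeomorphism `e` between open subsets of `X`:
`θₙ = eⁿ`, on the set of the points where `eⁿ` is defined. -/
def PartialAction.ofPowers : PartialAction X where
  map := intPower e
  map_zero := rfl
  map_neg := intPower_neg e
  map_add_source n m _ hx hy := (intPower_add e n m hx hy).1
  map_add_apply n m _ hx hy := (intPower_add e n m hx hy).2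

end Powers

/-! ### AF algebras -/

/-- A C⋆-algebra is an AF algebra if it is the closure of the union of an increasing sequence of
finite-dimensional C⋆-subalgebras. -/
def IsAFAlgebra (A : Type u) [NonUnitalCStarAlgebra A] : Prop :=
  ∃ S : ℕ → NonUnitalStarSubalgebra ℂ A,
    Monotone S ∧ (∀ n, FiniteDimensional ℂ (S n)) ∧ Dense (⋃ n, (S n : Set A))

/-! ### Ordered Bratteli diagrams -/

/-- A Bratteli diagram together with partial orders on the edge sets `Eₙ`, `n ≥ 1`, such that two
edges are comparable if and only if they have the same terminal vertex. -/
structure OrderedBratteliDiagram where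
  /-- The vertex set at level `n`. -/
  V : ℕ → Type u
  /-- The set of the edges from level `n` to level `n + 1`. -/
  E : ℕ → Type v
  /-- The initial vertex. -/
  i : ∀ {n}, E n → V n
  /-- The terminal vertex. -/
  t : ∀ {n}, E n → V (n + 1)
  finite_V : ∀ n, Finite (V n)
  nonempty_V : ∀ n, Nonempty (V n)
  finite_E : ∀ n, Finite (E n)
  nonempty_E : ∀ n, Nonempty (E n)
  subsingleton_V_zero : Subsingleton (V 0)
  no_sink : ∀ {n} (x : V n), ∃ e : E n, i e = x
  no_source : ∀ {n} (x : V (n + 1)), ∃ e : E n, t e = x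
  order : ∀ n, PartialOrder (E (n + 1))
  comparable_iff : ∀ {n} (e f : E (n + 1)), (e ≤ f ∨ f ≤ e) ↔ t e = t f

namespace OrderedBratteliDiagram

variable (D : OrderedBratteliDiagram.{u, v})

instance (n : ℕ) : PartialOrder (D.E (n + 1)) := D.order n

instance (n : ℕ) : Finite (D.E n) := D.finite_E n

/-- The (finite) edge sets carry the discrete topology. -/
instance (n : ℕ) : TopologicalSpace (D.E n) := ⊥

instance (n : ℕ) : DiscreteTopology (D.E n) := ⟨rfl⟩

/-- The ordered Bratteli diagram is stationary: for some `N`, every `Vₙ` with `n ≥ 1` consists of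
`N` vertices, labelled by `Fin N`, and every `Eₙ` with `n ≥ 1` is a copy of `E₁`, with the same
labels of the initial and terminal vertices and with the same order. -/
def IsStationary : Prop :=
  ∃ (N : ℕ) (L : ∀ n, D.V (n + 1) ≃ Fin N) (φ : ∀ n, D.E (n + 1) ≃o D.E (0 + 1)),
    ∀ n (e : D.E (n + 1)),
      L n (D.i e) = L 0 (D.i (φ n e)) ∧ L (n + 1) (D.t e) = L (0 + 1) (D.t (φ n e))

/-- The infinite path space `X`, a subspace of the product of the `Eₙ`, `n ≥ 1`. The coordinate
`ξ n` is the edge of the path `ξ` in `Eₙ₊₁`. -/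
abbrev PathSpace : Type v :=
  {ξ : ∀ n, D.E (n + 1) // ∀ n, D.t (ξ n) = D.i (ξ (n + 1))}

instance : CompactSpace D.PathSpace := by
  refine isCompact_iff_compactSpace.mp (IsClosed.isCompact ?_)
  change IsClosed {ξ : ∀ n, D.E (n + 1) | ∀ n, D.t (ξ n) = D.i (ξ (n + 1))}
  rw [Set.ofPred_forall]
  refine isClosed_iInter fun n => ?_
  let F : (∀ n, D.E (n + 1)) → D.E (n + 1) × D.E (n + 1 + 1) := fun ξ => (ξ n, ξ (n + 1))
  have hF : Continuous F := (continuous_apply n).prodMk (continuous_apply (n + 1))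
  exact (isClosed_discrete {p : D.E (n + 1) × D.E (n + 1 + 1) | D.t p.1 = D.i p.2}).preimage hF

/-- `η` is the successor of `ξ`: for some `n`, the edges of `ξ` before the `n`-th one are maximal,
the `n`-th edge of `η` is the successor of the `n`-th edge of `ξ`, the edges of `η` before the
`n`-th one are minimal, and both paths agree after the `n`-th edge. -/
def IsSuccessor (ξ η : D.PathSpace) : Prop :=
  ∃ n, (∀ j < n, IsMax (ξ.1 j)) ∧ ξ.1 n ⋖ η.1 n ∧ (∀ j < n, IsMin (η.1 j)) ∧
    ∀ j, n < j → η.1 j = ξ.1 j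

/-- The same diagram with the reversed orders. -/
def dual : OrderedBratteliDiagram.{u, v} :=
  { D with
    order := fun n => inferInstanceAs (PartialOrder (D.E (n + 1))ᵒᵈ)
    comparable_iff := fun e f => or_comm.trans (D.comparable_iff e f) }

theorem isSuccessor_dual_iff (ξ η : D.PathSpace) :
    D.dual.IsSuccessor η ξ ↔ D.IsSuccessor ξ η := by
  constructor
  · rintro ⟨n, h1, h2, h3, h4⟩
    exact ⟨n, h3, ⟨h2.1, fun c hc hc' => h2.2 hc' hc⟩, h1, fun j hj => (h4 j hj).symm⟩
  · rintro ⟨n, h1, h2, h3, h4⟩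
    exact ⟨n, h3, ⟨h2.1, fun c hc hc' => h2.2 hc' hc⟩, h1, fun j hj => (h4 j hj).symm⟩

variable {D}

theorem t_eq_of_le {n : ℕ} {e f : D.E (n + 1)} (h : e ≤ f) : D.t e = D.t f :=
  (D.comparable_iff e f).mp (Or.inl h)

theorem exists_isMin {n : ℕ} (x : D.V (n + 1 + 1)) : ∃ e : D.E (n + 1), IsMin e ∧ D.t e = x := by
  obtain ⟨f, hf⟩ := D.no_source x
  obtain ⟨e, he, hmin⟩ := (Set.toFinite (Set.univ : Set (D.E (n + 1)))).exists_le_minimal (Set.mem_univ f)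
  refine ⟨e, ?_, (t_eq_of_le he).trans hf⟩
  exact fun b hb => hmin.2 (Set.mem_univ b) hb

theorem eq_of_isMin {n : ℕ} {e f : D.E (n + 1)} (he : IsMin e) (hf : IsMin f)
    (h : D.t e = D.t f) : e = f := by
  rcases (D.comparable_iff e f).mpr h with h | h
  · exact le_antisymm h (hf h)
  · exact le_antisymm (he h) h

theorem eq_of_covBy {n : ℕ} {e f g : D.E (n + 1)} (hf : e ⋖ f) (hg : e ⋖ g) : f = g := by
  have h : D.t f = D.t g := (t_eq_of_le hf.le).symm.trans (t_eq_of_le hg.le)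
  rcases (D.comparable_iff f g).mpr h with h | h
  · rcases h.eq_or_lt with h | h
    · exact h
    · exact absurd h (hg.2 hf.1)
  · rcases h.eq_or_lt with h | h
    · exact h.symm
    · exact absurd h (hf.2 hg.1)

theorem exists_covBy {n : ℕ} {e : D.E (n + 1)} (he : ¬ IsMax e) : ∃ f, e ⋖ f := by
  obtain ⟨g, hg⟩ := not_isMax_iff.mp he
  obtain ⟨f, _, hf⟩ := (Set.toFinite {f : D.E (n + 1) | e < f}).exists_le_minimal hg
  exact ⟨f, hf.1, fun c hc hcf => absurd (hf.2 hc hcf.le) (not_le_of_gt hcf)⟩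

/-- The part of a path from the `n`-th edge on can be completed to a path by minimal edges. -/
theorem exists_path (n : ℕ) (ξ : ∀ n, D.E (n + 1))
    (h : ∀ j, n ≤ j → D.t (ξ j) = D.i (ξ (j + 1))) :
    ∃ η : D.PathSpace, (∀ j < n, IsMin (η.1 j)) ∧ ∀ j, n ≤ j → η.1 j = ξ j := by
  induction n generalizing ξ with
  | zero => exact ⟨⟨ξ, fun j => h j (Nat.zero_le j)⟩, by simp, fun _ _ => rfl⟩
  | succ n ih =>
    obtain ⟨e, he, hte⟩ := exists_isMin (D.i (ξ (n + 1)))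
    obtain ⟨η, h1, h2⟩ := ih (Function.update ξ n e) (by
      intro j hj
      rcases hj.eq_or_lt with rfl | hj
      · rw [Function.update_self, Function.update_of_ne (Nat.succ_ne_self n), hte]
      · rw [Function.update_of_ne hj.ne', Function.update_of_ne (by omega)]
        exact h j hj)
    refine ⟨η, fun j hj => ?_, fun j hj => ?_⟩
    · rcases (Nat.lt_succ_iff.mp hj).eq_or_lt with rfl | hj
      · rw [h2 j le_rfl, Function.update_self]; exact he
      · exact h1 j hj
    · rw [h2 j (by omega), Function.update_of_ne (by omega)]

theorem path_unique (n : ℕ) (η η' : D.PathSpace) (h : ∀ j < n, IsMin (η.1 j))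
    (h' : ∀ j < n, IsMin (η'.1 j)) (k : ℕ) (hk : ∀ j, n ≤ j → j ≤ k → η.1 j = η'.1 j)
    (hnk : n ≤ k) : ∀ j ≤ k, η.1 j = η'.1 j := by
  induction n with
  | zero => exact fun j hj => hk j (Nat.zero_le j) hj
  | succ n ih =>
    refine ih (fun j hj => h j (by omega)) (fun j hj => h' j (by omega)) (fun j hj hjk => ?_)
      (by omega)
    rcases hj.eq_or_lt with rfl | hj
    · refine eq_of_isMin (h n (by omega)) (h' n (by omega)) ?_
      rw [η.2, η'.2, hk (n + 1) le_rfl hnk]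
    · exact hk j hj hjk

theorem exists_isSuccessor {ξ : D.PathSpace} (h : ∃ n, ¬ IsMax (ξ.1 n)) :
    ∃ η, D.IsSuccessor ξ η := by
  classical
  obtain ⟨g, hg⟩ := exists_covBy (Nat.find_spec h)
  obtain ⟨η, h1, h2⟩ := exists_path (Nat.find h) (Function.update ξ.1 (Nat.find h) g) (by
    intro j hj
    rcases hj.eq_or_lt with hj | hj
    · subst hj
      rw [Function.update_self, Function.update_of_ne (Nat.succ_ne_self _), ← t_eq_of_le hg.le]
      exact ξ.2 _
    · rw [Function.update_of_ne hj.ne', Function.update_of_ne (by omega)]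
      exact ξ.2 j)
  refine ⟨η, Nat.find h, fun j hj => not_not.mp (Nat.find_min h hj), ?_, h1, fun j hj => ?_⟩
  · rw [h2 _ le_rfl, Function.update_self]; exact hg
  · rw [h2 j hj.le, Function.update_of_ne hj.ne']

/-- If `ξ` and `ξ'` agree up to the edge `k`, and `ξ` changes at an edge `n ≤ k`, then their
successors agree up to the edge `k`. -/
theorem isSuccessor_local {ξ ξ' η η' : D.PathSpace} {n k : ℕ} (hnk : n ≤ k)
    (hk : ∀ j ≤ k, ξ.1 j = ξ'.1 j) (hn : ¬ IsMax (ξ.1 n))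
    (h : D.IsSuccessor ξ η) (h' : D.IsSuccessor ξ' η') : ∀ j ≤ k, η.1 j = η'.1 j := by
  obtain ⟨p, h1, h2, h3, h4⟩ := h
  obtain ⟨q, h1', h2', h3', h4'⟩ := h'
  have hpn : p ≤ n := by
    by_contra hlt
    exact hn (h1 n (by omega))
  have hp : ¬ IsMax (ξ.1 p) := fun hm => hm.not_lt h2.1
  have hq : ¬ IsMax (ξ'.1 q) := fun hm => hm.not_lt h2'.1
  have hpq : p = q := by
    rcases lt_trichotomy p q with hlt | heq | hlt
    · exact absurd (hk p (by omega) ▸ h1' p hlt) hp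
    · exact heq
    · exact absurd (hk q (by omega) ▸ h1 q hlt) hq
  subst hpq
  refine path_unique p η η' h3 h3' k (fun j hj hjk => ?_) (by omega)
  rcases hj.eq_or_lt with rfl | hj
  · rw [← hk p hjk] at h2'
    exact eq_of_covBy h2 h2'
  · rw [h4 j hj, h4' j hj, hk j hjk]

theorem isSuccessor_unique {ξ η η' : D.PathSpace} (h : D.IsSuccessor ξ η)
    (h' : D.IsSuccessor ξ η') : η = η' := by
  obtain ⟨n, hn⟩ := id h
  have hmax : ¬ IsMax (ξ.1 n) := fun hm => hm.not_lt hn.2.1.1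
  refine Subtype.ext (funext fun j => ?_)
  exact isSuccessor_local (le_max_left n j) (fun _ _ => rfl) hmax h h' j (le_max_right n j)

theorem isSuccessor_source {ξ η : D.PathSpace} (h : D.IsSuccessor ξ η) : ∃ n, ¬ IsMax (ξ.1 n) := by
  obtain ⟨n, hn⟩ := h
  exact ⟨n, fun hm => hm.not_lt hn.2.1.1⟩

variable (D)

/-- `X_max`, the set of the infinite paths all of whose edges are maximal. -/
def Xmax : Set D.PathSpace := {ξ | ∀ n, IsMax (ξ.1 n)}

/-- `X_min`, the set of the infinite paths all of whose edges are minimal. -/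
def Xmin : Set D.PathSpace := {ξ | ∀ n, IsMin (ξ.1 n)}

open Classical in
/-- The Vershik map as a total function: the successor of `ξ`, which exists if and only if `ξ` is
not in `X_max` (and the junk value `ξ` otherwise). -/
def succPath (ξ : D.PathSpace) : D.PathSpace :=
  if h : ∃ η, D.IsSuccessor ξ η then h.choose else ξ

theorem succPath_eq {ξ η : D.PathSpace} (h : D.IsSuccessor ξ η) : D.succPath ξ = η := by
  have h' : ∃ η, D.IsSuccessor ξ η := ⟨η, h⟩
  rw [succPath, dif_pos h']
  exact isSuccessor_unique h'.choose_spec h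

theorem succPath_spec {ξ : D.PathSpace} (h : ξ ∈ D.Xmaxᶜ) : D.IsSuccessor ξ (D.succPath ξ) := by
  obtain ⟨η, hη⟩ := exists_isSuccessor (not_forall.mp h)
  rwa [D.succPath_eq hη]

theorem isOpen_compl_Xmax : IsOpen D.Xmaxᶜ := by
  have : D.Xmax = ⋂ n, {ξ : D.PathSpace | IsMax (ξ.1 n)} := by
    ext ξ; simp [Xmax]
  rw [this, isOpen_compl_iff]
  refine isClosed_iInter fun n => ?_
  have hc : Continuous fun ξ : D.PathSpace => ξ.1 n :=
    (continuous_apply n).comp continuous_subtype_val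
  exact (isClosed_discrete {e : D.E (n + 1) | IsMax e}).preimage hc

theorem continuousOn_succPath : ContinuousOn D.succPath D.Xmaxᶜ := by
  intro ξ hξ
  refine ContinuousAt.continuousWithinAt ?_
  obtain ⟨n, hn⟩ := not_forall.mp hξ
  rw [ContinuousAt, tendsto_subtype_rng, tendsto_pi_nhds]
  intro j
  rw [nhds_discrete (D.E (j + 1)), Filter.tendsto_pure]
  have hev : ∀ᶠ ξ' in 𝓝 ξ, ∀ l ∈ Finset.range (max n j + 1), ξ.1 l = ξ'.1 l := by
    rw [Filter.eventually_all_finset]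
    intro l _
    have hc : Filter.Tendsto (fun ξ' : D.PathSpace => ξ'.1 l) (𝓝 ξ) (𝓝 (ξ.1 l)) :=
      ((continuous_apply l).comp continuous_subtype_val).continuousAt
    rw [nhds_discrete (D.E (l + 1)), Filter.tendsto_pure] at hc
    exact hc.mono fun _ h => h.symm
  filter_upwards [hev, D.isOpen_compl_Xmax.mem_nhds hξ] with ξ' h1 h2
  exact (isSuccessor_local (le_max_left n j)
    (fun l hl => h1 l (Finset.mem_range.mpr (Nat.lt_succ_of_le hl))) hn
    (D.succPath_spec hξ) (D.succPath_spec h2) j (le_max_right n j)).symm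

/-- The Vershik map `λ`, a homeomorphism from the open set `X₋₁ = X ∖ X_max` onto the open set
`X₁ = X ∖ X_min`. -/
def vershik : OpenPartialHomeomorph D.PathSpace D.PathSpace where
  toFun := D.succPath
  invFun := D.dual.succPath
  source := D.Xmaxᶜ
  target := D.Xminᶜ
  map_source' _ hξ := not_forall.mpr
    (isSuccessor_source ((D.isSuccessor_dual_iff _ _).mpr (D.succPath_spec hξ)))
  map_target' _ hξ := not_forall.mpr
    (isSuccessor_source ((D.isSuccessor_dual_iff _ _).mp (D.dual.succPath_spec hξ)))
  left_inv' _ hξ := D.dual.succPath_eq ((D.isSuccessor_dual_iff _ _).mpr (D.succPath_spec hξ))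
  right_inv' _ hξ := D.succPath_eq ((D.isSuccessor_dual_iff _ _).mp (D.dual.succPath_spec hξ))
  open_source := D.isOpen_compl_Xmax
  open_target := D.dual.isOpen_compl_Xmax
  continuousOn_toFun := D.continuousOn_succPath
  continuousOn_invFun := D.dual.continuousOn_succPath

/-- The partial action of `ℤ` on the path space given by the powers of the Vershik map. -/
def vershikAction : PartialAction D.PathSpace := PartialAction.ofPowers D.vershik

end OrderedBratteliDiagram

end

/-! Write λ for the Vershik map. Where λⁿ is defined, it alters only finitely many edges, so the
crossed product should be exhausted by the parts that see only the first `k` edges. Let A_k be the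
span of the elements a δₙ such that a depends on the first `k` edges only and is supported at points
y for which λ⁻ⁿ y is defined and has the same edges as y from the `k`-th on. The A_k increase with
`k`.

The main tool is locality (`PowerRel.congr`): whether λⁿ carries x to y, for x and y with the same
tail from `k`, depends only on `n` and on the two prefixes of length `k`. Hence A_k is closed under
products and adjoints. The other tool is that λ strictly increases the reverse lexicographic order,
so that no nonzero power has a fixed point (`PowerRel.eq_zero`). Together they show that a pair of
prefixes determines the exponent `n`. There are finitely many pairs, so finitely many exponents
occur in A_k (`finite_powers`); for each of them the coefficient is determined by finitely many
values, and A_k is finite-dimensional.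

For density, the norm of a δₙ is at most the supremum norm of a, so it suffices to approximate a ∈
C₀(Xₙ) uniformly (`exists_levelSubmodule_near`). Every point of Xₙ satisfies the support condition
for some `k`, and a is small near the points outside Xₙ; compactness of the path space gives one `k`
for all points. -/

noncomputable section

namespace OrderedBratteliDiagram

variable {D : OrderedBratteliDiagram.{u, v}}

/-! ### The orbits of the Vershik map -/

/-- The two paths have the same edges before the `k`-th one. -/
def SamePrefix (k : ℕ) (x y : D.PathSpace) : Prop := ∀ j < k, x.1 j = y.1 j

/-- The two paths have the same edges from the `k`-th one on. -/
def SameTail (k : ℕ) (x y : D.PathSpace) : Prop := ∀ j, k ≤ j → x.1 j = y.1 j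

/-- The strict reverse lexicographic order on the paths with a common tail. -/
def RevLexLT (x y : D.PathSpace) : Prop := ∃ n, x.1 n < y.1 n ∧ ∀ j, n < j → x.1 j = y.1 j

/-- The `n`-th power of the Vershik map is defined at `x` and sends `x` to `y`. -/
def PowerRel (n : ℤ) (x y : D.PathSpace) : Prop :=
  x ∈ (D.vershikAction.map n).source ∧ D.vershikAction.map n x = y

/-! ### Prefixes, tails and the reverse lexicographic order -/

theorem SamePrefix.symm {k : ℕ} {x y : D.PathSpace} (h : SamePrefix k x y) : SamePrefix k y x :=
  fun j hj => (h j hj).symm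

theorem SamePrefix.trans {k : ℕ} {x y z : D.PathSpace} (h : SamePrefix k x y)
    (h' : SamePrefix k y z) : SamePrefix k x z := fun j hj => (h j hj).trans (h' j hj)

theorem SamePrefix.mono {k l : ℕ} (hkl : k ≤ l) {x y : D.PathSpace} (h : SamePrefix l x y) :
    SamePrefix k x y := fun j hj => h j (hj.trans_le hkl)

theorem SameTail.symm {k : ℕ} {x y : D.PathSpace} (h : SameTail k x y) : SameTail k y x :=
  fun j hj => (h j hj).symm

theorem SameTail.trans {k : ℕ} {x y z : D.PathSpace} (h : SameTail k x y)
    (h' : SameTail k y z) : SameTail k x z := fun j hj => (h j hj).trans (h' j hj)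

theorem SameTail.mono {k l : ℕ} (hkl : k ≤ l) {x y : D.PathSpace} (h : SameTail k x y) :
    SameTail l x y := fun j hj => h j (hkl.trans hj)

theorem ext_of_prefix_tail {k : ℕ} {x y : D.PathSpace} (h : SamePrefix k x y)
    (h' : SameTail k x y) : x = y :=
  Subtype.ext (funext fun j => (lt_or_ge j k).elim (h j) (h' j))

/-- The initial part of `y` can be joined to the tail of `x'` if `x'` begins like a path `x` that
has the tail of `y`. -/
theorem exists_splice {k : ℕ} {x y x' : D.PathSpace} (ht : SameTail k x y)
    (hp : SamePrefix k x x') : ∃ y', SamePrefix k y y' ∧ SameTail k x' y' := by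
  refine ⟨⟨fun j => if j < k then y.1 j else x'.1 j, fun j => ?_⟩, fun j hj => ?_, fun j hj => ?_⟩
  · dsimp only
    rcases lt_trichotomy (j + 1) k with h | h | h
    · rw [if_pos h, if_pos (by omega)]
      exact y.2 j
    -- The seam: `y` and `x` share the edge `k`, and `x` and `x'` share the edge `k - 1`, so the
    -- prefix of `y` ends at the vertex where the tail of `x'` starts.
    · rw [if_pos (by omega), if_neg (by omega), y.2 j, ← ht (j + 1) h.ge, ← x.2 j,
        hp j (by omega), x'.2 j]
    · rw [if_neg (by omega), if_neg (by omega)]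
      exact x'.2 j
  · simp [hj]
  · simp [not_lt.mpr hj]

theorem RevLexLT.irrefl (x : D.PathSpace) : ¬ RevLexLT x x := fun ⟨_, h, _⟩ => lt_irrefl _ h

theorem RevLexLT.trans {x y z : D.PathSpace} (h : RevLexLT x y) (h' : RevLexLT y z) :
    RevLexLT x z := by
  obtain ⟨n, h1, h2⟩ := h
  obtain ⟨m, h3, h4⟩ := h'
  rcases lt_trichotomy n m with h | h | h
  · exact ⟨m, (h2 m h).trans_lt h3, fun j hj => (h2 j (h.trans hj)).trans (h4 j hj)⟩
  · subst h
    exact ⟨n, h1.trans h3, fun j hj => (h2 j hj).trans (h4 j hj)⟩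
  · exact ⟨n, h1.trans_eq (h4 n h), fun j hj => (h2 j hj).trans (h4 j (h.trans hj))⟩

/-- A path between two paths with the same tail has this tail, too. -/
theorem RevLexLT.sameTail_of_sameTail {k : ℕ} {x y z : D.PathSpace} (h : RevLexLT x y)
    (h' : RevLexLT y z) (hk : SameTail k x z) : SameTail k x y := by
  obtain ⟨n, h1, h2⟩ := h
  obtain ⟨m, h3, h4⟩ := h'
  -- Otherwise `x` and `z` would differ at the larger of `n` and `m`, an index at least `k`.
  have hn : n < k := by
    by_contra hn
    have hn := not_lt.mp hn
    rcases lt_trichotomy n m with h | h | h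
    · exact ((h2 m h).trans_lt h3).ne (hk m (hn.trans h.le))
    · subst h
      exact (h1.trans h3).ne (hk n hn)
    · exact (h1.trans_eq (h4 n h)).ne (hk n hn)
  exact fun j hj => h2 j (hn.trans_le hj)

theorem IsSuccessor.revLexLT {x y : D.PathSpace} (h : D.IsSuccessor x y) : RevLexLT x y := by
  obtain ⟨n, _, h2, _, h4⟩ := h
  exact ⟨n, h2.1, fun j hj => (h4 j hj).symm⟩

/-- Since the tails agree, the edge that is replaced by its successor lies before `k`. All
conditions on maximal, minimal and covering edges are then read off from the prefixes. -/
theorem IsSuccessor.congr {k : ℕ} {x y x' y' : D.PathSpace} (h : D.IsSuccessor x y)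
    (ht : SameTail k x y) (ht' : SameTail k x' y') (hx : SamePrefix k x x')
    (hy : SamePrefix k y y') : D.IsSuccessor x' y' := by
  obtain ⟨n, h1, h2, h3, h4⟩ := h
  have hn : n < k := by
    by_contra hn
    exact h2.1.ne (ht n (not_lt.mp hn))
  refine ⟨n, fun j hj => ?_, ?_, fun j hj => ?_, fun j hj => ?_⟩
  · rw [← hx j (hj.trans hn)]; exact h1 j hj
  · rw [← hx n hn, ← hy n hn]; exact h2
  · rw [← hy j (hj.trans hn)]; exact h3 j hj
  · rcases lt_or_ge j k with hjk | hjk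
    · rw [← hx j hjk, ← hy j hjk]; exact h4 j hj
    · exact (ht' j hjk).symm

/-! ### Powers of the Vershik map: no periodic points, and locality -/

namespace PowerRel

theorem symm {n : ℤ} {x y : D.PathSpace} (h : PowerRel n x y) : PowerRel (-n) y x := by
  obtain ⟨h, rfl⟩ := h
  refine ⟨?_, ?_⟩
  · rw [PartialAction.source_neg]
    exact (D.vershikAction.map n).map_source h
  · rw [D.vershikAction.map_neg]
    exact (D.vershikAction.map n).left_inv h

theorem symm_iff {n : ℤ} {x y : D.PathSpace} : PowerRel (-n) y x ↔ PowerRel n x y :=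
  ⟨fun h => by simpa using h.symm, symm⟩

theorem of_mem_target {n : ℤ} {x : D.PathSpace} (h : x ∈ (D.vershikAction.map n).target) :
    PowerRel n ((D.vershikAction.map n).symm x) x :=
  ⟨(D.vershikAction.map n).map_target h, (D.vershikAction.map n).right_inv h⟩

theorem mem_target {n : ℤ} {x y : D.PathSpace} (h : PowerRel n x y) :
    y ∈ (D.vershikAction.map n).target :=
  h.2 ▸ (D.vershikAction.map n).map_source h.1

theorem symm_apply {n : ℤ} {x y : D.PathSpace} (h : PowerRel n x y) :
    (D.vershikAction.map n).symm y = x :=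
  h.2 ▸ (D.vershikAction.map n).left_inv h.1

theorem add {n m : ℤ} {x y z : D.PathSpace} (h : PowerRel m x y) (h' : PowerRel n y z) :
    PowerRel (n + m) x z := by
  obtain ⟨h1, rfl⟩ := h
  exact ⟨D.vershikAction.map_add_source _ _ _ h1 h'.1,
    (D.vershikAction.map_add_apply _ _ _ h1 h'.1).trans h'.2⟩

theorem zero_iff {x y : D.PathSpace} : PowerRel 0 x y ↔ x = y := by
  rw [PowerRel, D.vershikAction.map_zero]
  exact ⟨fun h => h.2, fun h => ⟨trivial, h⟩⟩

theorem exists_of_succ {n : ℕ} {x y : D.PathSpace} (h : PowerRel ((n + 1 : ℕ) : ℤ) x y) :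
    ∃ z, PowerRel (n : ℤ) x z ∧ D.IsSuccessor z y := by
  obtain ⟨h1, h2⟩ := h
  change x ∈ ((iterPower D.vershik n).trans D.vershik).source at h1
  rw [OpenPartialHomeomorph.trans_source] at h1
  refine ⟨iterPower D.vershik n x, ⟨h1.1, rfl⟩, ?_⟩
  rw [← h2]
  exact D.succPath_spec h1.2

theorem succ {n : ℕ} {x y z : D.PathSpace} (h : PowerRel (n : ℤ) x z)
    (h' : D.IsSuccessor z y) : PowerRel ((n + 1 : ℕ) : ℤ) x y := by
  obtain ⟨h1, rfl⟩ := h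
  refine ⟨?_, D.succPath_eq h'⟩
  change x ∈ ((iterPower D.vershik n).trans D.vershik).source
  rw [OpenPartialHomeomorph.trans_source]
  exact ⟨h1, not_forall.mpr (isSuccessor_source h')⟩

/-- Each single step is an increase, and the order is transitive. This one fact yields the absence
of fixed points, the common tail of the two endpoints, and control over the intermediate points in
`congr`. -/
theorem revLexLT {n : ℕ} (hn : n ≠ 0) {x y : D.PathSpace} (h : PowerRel (n : ℤ) x y) :
    RevLexLT x y := by
  induction n generalizing y with
  | zero => exact absurd rfl hn
  | succ n ih =>
    obtain ⟨z, hz, hs⟩ := exists_of_succ h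
    rcases eq_or_ne n 0 with rfl | hn
    · obtain rfl := zero_iff.mp hz
      exact hs.revLexLT
    · exact (ih hn hz).trans hs.revLexLT

/-- The powers of the Vershik map have no fixed points. -/
theorem eq_zero {n : ℤ} {x : D.PathSpace} (h : PowerRel n x x) : n = 0 := by
  obtain ⟨k, rfl | rfl⟩ := n.eq_nat_or_neg
  · by_contra hk
    exact RevLexLT.irrefl x (h.revLexLT (by exact_mod_cast hk))
  · by_contra hk
    exact RevLexLT.irrefl x ((symm_iff.mp h).revLexLT (by rintro rfl; exact hk rfl))

/-- Paths comparable in the reverse lexicographic order agree after their last difference. For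
density this means that each point of Xₙ meets the support condition of some level. -/
theorem exists_sameTail {n : ℤ} {x y : D.PathSpace} (h : PowerRel n x y) :
    ∃ k, SameTail k x y := by
  have key : ∀ (n : ℕ) {x y : D.PathSpace}, PowerRel (n : ℤ) x y → ∃ k, SameTail k x y := by
    intro n x y h
    rcases eq_or_ne n 0 with rfl | hn
    · exact ⟨0, fun j _ => by rw [zero_iff.mp h]⟩
    · obtain ⟨k, _, hk⟩ := h.revLexLT hn
      exact ⟨k + 1, hk⟩
  obtain ⟨k, rfl | rfl⟩ := n.eq_nat_or_neg
  · exact key k h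
  · exact (key k (symm_iff.mp h)).imp fun _ => SameTail.symm

/-- The powers of the Vershik map are local: if the edges from the `k`-th one on do not change, then
they play no role. -/
theorem congr {n : ℤ} {k : ℕ} {x y x' y' : D.PathSpace} (h : PowerRel n x y)
    (ht : SameTail k x y) (ht' : SameTail k x' y') (hx : SamePrefix k x x')
    (hy : SamePrefix k y y') : PowerRel n x' y' := by
  have key : ∀ (n : ℕ) {x y x' y' : D.PathSpace}, PowerRel (n : ℤ) x y → SameTail k x y →
      SameTail k x' y' → SamePrefix k x x' → SamePrefix k y y' → PowerRel (n : ℤ) x' y' := by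
    intro n
    induction n with
    | zero =>
      intro x y x' y' h ht ht' hx hy
      obtain rfl := zero_iff.mp h
      exact zero_iff.mpr (ext_of_prefix_tail (hx.symm.trans hy) ht')
    | succ n ih =>
      intro x y x' y' h ht ht' hx hy
      obtain ⟨z, hz, hs⟩ := exists_of_succ h
      -- The intermediate point `z` lies between `x` and `y` in the order, so it keeps their common
      -- tail and can be transplanted onto the tail of `x'`.
      have hxz : SameTail k x z := by
        rcases eq_or_ne n 0 with rfl | hn
        · obtain rfl := zero_iff.mp hz
          exact fun _ _ => rfl
        · exact (hz.revLexLT hn).sameTail_of_sameTail hs.revLexLT ht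
      obtain ⟨z', hz', hxz'⟩ := exists_splice hxz hx
      exact (ih hz hxz hxz' hx hz').succ
        (hs.congr (hxz.symm.trans ht) (hxz'.symm.trans ht') hz' hy)
  obtain ⟨m, rfl | rfl⟩ := n.eq_nat_or_neg
  · exact key m h ht ht' hx hy
  · exact symm_iff.mpr (key m (symm_iff.mp h) ht.symm ht'.symm hy hx)

/-- Locality as it is applied below: the image of `x'` need not be given in advance, as it is the
prefix of `y` spliced onto the tail of `x'`. -/
theorem exists_of_samePrefix {n : ℤ} {k : ℕ} {x y x' : D.PathSpace} (h : PowerRel n x y)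
    (ht : SameTail k x y) (hx : SamePrefix k x x') :
    ∃ y', PowerRel n x' y' ∧ SamePrefix k y y' ∧ SameTail k x' y' := by
  obtain ⟨y', h1, h2⟩ := exists_splice ht hx
  exact ⟨y', h.congr ht h2 hx h1, h1, h2⟩

end PowerRel

/-! ### Finite-dimensional subalgebras -/

/-- The first `k` edges of a path. -/
def pathPrefix (k : ℕ) (x : D.PathSpace) : ∀ j : Fin k, D.E (j + 1) := fun j => x.1 j

theorem pathPrefix_eq_iff {k : ℕ} {x y : D.PathSpace} :
    pathPrefix k x = pathPrefix k y ↔ SamePrefix k x y :=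
  ⟨fun h j hj => congr_fun h ⟨j, hj⟩, fun h => funext fun j => h j j.2⟩

theorem continuous_pathPrefix (k : ℕ) : Continuous (pathPrefix (D := D) k) :=
  continuous_pi fun j => (continuous_apply (j : ℕ)).comp continuous_subtype_val

/-- Such a set is the preimage of a set of prefixes under a continuous map to a discrete space. -/
theorem isOpen_of_samePrefix {k : ℕ} {s : Set D.PathSpace}
    (h : ∀ x y, SamePrefix k x y → x ∈ s → y ∈ s) : IsOpen s := by
  have hs : s = pathPrefix k ⁻¹' (pathPrefix k '' s) := by
    refine (Set.subset_preimage_image _ _).antisymm ?_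
    rintro y ⟨x, hx, hxy⟩
    exact h x y (pathPrefix_eq_iff.mp hxy) hx
  rw [hs]
  exact (isOpen_discrete _).preimage (continuous_pathPrefix k)

theorem exists_samePrefix_subset {x : D.PathSpace} {s : Set D.PathSpace} (hs : s ∈ 𝓝 x) :
    ∃ k, ∀ y, SamePrefix k x y → y ∈ s := by
  rw [nhds_subtype_eq_comap, Filter.mem_comap] at hs
  obtain ⟨t, ht, hts⟩ := hs
  rw [nhds_pi, Filter.mem_pi] at ht
  obtain ⟨I, hI, u, hu, hut⟩ := ht
  obtain ⟨k, hk⟩ := hI.bddAbove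
  -- A basic neighbourhood constrains finitely many coordinates, all at most `k`; a prefix of length
  -- `k + 1` includes the edge `k`.
  refine ⟨k + 1, fun y hy => hts (hut fun j hj => ?_)⟩
  rw [← hy j (Nat.lt_succ_of_le (hk hj))]
  exact mem_of_mem_nhds (hu j)

/-- The functions in `C₀(Xₙ)` that depend on the first `k` edges only and vanish at every path for
which `θ₋ₙ` is undefined or changes one of the other edges. -/
def levelSubmodule (k : ℕ) (n : ℤ) : Submodule ℂ (D.vershikAction.C₀ n) where
  carrier := {a | (∀ x y, SamePrefix k x y →
      (a : C(D.PathSpace, ℂ)) x = (a : C(D.PathSpace, ℂ)) y) ∧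
    ∀ y, (a : C(D.PathSpace, ℂ)) y ≠ 0 → ∃ x, PowerRel n x y ∧ SameTail k x y}
  zero_mem' := ⟨fun _ _ _ => rfl, fun _ h => absurd rfl h⟩
  add_mem' := by
    rintro a b ⟨ha, ha'⟩ ⟨hb, hb'⟩
    refine ⟨fun x y h => ?_, fun y hy => ?_⟩
    · simp [ha x y h, hb x y h]
    · by_cases h : (a : C(D.PathSpace, ℂ)) y = 0
      · refine hb' y fun h' => hy ?_
        simp [h, h']
      · exact ha' y h
  smul_mem' := by
    rintro c a ⟨ha, ha'⟩
    refine ⟨fun x y h => ?_, fun y hy => ha' y fun h => hy ?_⟩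
    · simp [ha x y h]
    · simp [h]

theorem levelSubmodule_mono {k l : ℕ} (hkl : k ≤ l) (n : ℤ) :
    levelSubmodule (D := D) k n ≤ levelSubmodule l n := by
  rintro a ⟨ha, ha'⟩
  refine ⟨fun x y h => ha x y (h.mono hkl), fun y hy => ?_⟩
  obtain ⟨x, hx, hxy⟩ := ha' y hy
  exact ⟨x, hx, hxy.mono hkl⟩

/-- Where `a` does not vanish, θ₋ₙ changes only the prefix, and by locality in a way that depends on
the prefix alone; so b ∘ θ₋ₙ depends on the prefix there. The support condition follows by composing
the two powers. -/
theorem gmul_mem_levelSubmodule {k : ℕ} {n m : ℤ} {a : D.vershikAction.C₀ n}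
    {b : D.vershikAction.C₀ m} (ha : a ∈ levelSubmodule k n) (hb : b ∈ levelSubmodule k m) :
    D.vershikAction.gmul a b ∈ levelSubmodule k (n + m) := by
  refine ⟨fun x y h => ?_, fun y hy => ?_⟩
  · rw [PartialAction.gmul_apply, PartialAction.gmul_apply, ← ha.1 x y h]
    by_cases h0 : (a : C(D.PathSpace, ℂ)) x = 0
    · rw [h0, zero_mul, zero_mul]
    · obtain ⟨x', hx', hxt⟩ := ha.2 x h0
      obtain ⟨y', hy', hp, _⟩ := hx'.symm.exists_of_samePrefix hxt.symm h
      rw [hx'.symm_apply, (PowerRel.symm_iff.mp hy').symm_apply, hb.1 x' y' hp]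
  · rw [PartialAction.gmul_apply] at hy
    obtain ⟨x, hx, hxt⟩ := ha.2 y (left_ne_zero_of_mul hy)
    have hb0 := right_ne_zero_of_mul hy
    rw [hx.symm_apply] at hb0
    obtain ⟨z, hz, hzt⟩ := hb.2 x hb0
    exact ⟨z, hz.add hx, hzt.trans hxt⟩

theorem gstar_mem_levelSubmodule {k : ℕ} {n : ℤ} {a : D.vershikAction.C₀ n}
    (ha : a ∈ levelSubmodule k n) : D.vershikAction.gstar a ∈ levelSubmodule k (-n) := by
  have key : ∀ x, (D.vershikAction.gstar a : C(D.PathSpace, ℂ)) x ≠ 0 →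
      ∃ y, PowerRel n x y ∧ SameTail k x y := by
    intro x hx
    by_cases h : x ∈ (D.vershikAction.map n).source
    · rw [PartialAction.gstar_apply _ _ h, star_ne_zero] at hx
      obtain ⟨x', hx', ht⟩ := ha.2 _ hx
      obtain rfl : x' = x := hx'.symm_apply.symm.trans ((D.vershikAction.map n).left_inv h)
      exact ⟨_, hx', ht⟩
    · exact absurd (PartialAction.gstar_apply_of_notMem _ _ h) hx
  have key' : ∀ x x', SamePrefix k x x' →
      (D.vershikAction.gstar a : C(D.PathSpace, ℂ)) x ≠ 0 →
      (D.vershikAction.gstar a : C(D.PathSpace, ℂ)) x =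
        (D.vershikAction.gstar a : C(D.PathSpace, ℂ)) x' := by
    intro x x' h hx
    obtain ⟨y, hy, ht⟩ := key x hx
    obtain ⟨y', hy', hp, _⟩ := hy.exists_of_samePrefix ht h
    rw [PartialAction.gstar_apply _ _ hy.1, PartialAction.gstar_apply _ _ hy'.1, hy.2, hy'.2,
      ha.1 y y' hp]
  refine ⟨fun x x' h => ?_, fun x hx => ?_⟩
  -- `key'` needs a nonzero value at its first point, so it is applied from whichever of the two
  -- points has one.
  · by_cases hx : (D.vershikAction.gstar a : C(D.PathSpace, ℂ)) x = 0
    · by_cases hx' : (D.vershikAction.gstar a : C(D.PathSpace, ℂ)) x' = 0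
      · rw [hx, hx']
      · exact (key' x' x h.symm hx').symm
    · exact key' x x' h hx
  · obtain ⟨y, hy, ht⟩ := key x hx
    exact ⟨y, hy.symm, ht.symm⟩

/-- Evaluation at one chosen path for each of the finitely many prefixes is injective on functions
of the prefix. -/
theorem finiteDimensional_levelSubmodule (k : ℕ) (n : ℤ) :
    FiniteDimensional ℂ (levelSubmodule (D := D) k n) := by
  let F : levelSubmodule (D := D) k n →ₗ[ℂ] (Set.range (pathPrefix (D := D) k) → ℂ) :=
    { toFun := fun a p => (a.1 : C(D.PathSpace, ℂ)) p.2.choose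
      map_add' := fun _ _ => rfl
      map_smul' := fun _ _ => rfl }
  refine FiniteDimensional.of_injective F fun a b hab => ?_
  refine Subtype.ext (Subtype.ext (ContinuousMap.ext fun x => ?_))
  have hp : pathPrefix k x ∈ Set.range (pathPrefix (D := D) k) := ⟨x, rfl⟩
  have hx := (pathPrefix_eq_iff.mp hp.choose_spec).symm
  rw [a.2.1 _ _ hx, b.2.1 _ _ hx]
  exact congr_fun hab ⟨_, hp⟩

/-- Only finitely many powers of the Vershik map change the first `k` edges only. -/
theorem finite_powers (k : ℕ) :
    {n : ℤ | ∃ x y : D.PathSpace, PowerRel n x y ∧ SameTail k x y}.Finite := by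
  refine Set.finite_coe_iff.mp ?_
  choose x y h ht using fun n : {n : ℤ | ∃ x y : D.PathSpace, PowerRel n x y ∧ SameTail k x y} => n.2
  refine Finite.of_injective (fun n => (pathPrefix k (x n), pathPrefix k (y n))) fun n m hnm => ?_
  obtain ⟨h1, h2⟩ := Prod.ext_iff.mp hnm
  -- By locality the `n`-th power also carries `x m` to `y m`. Going back by the `-m`-th power first
  -- gives a fixed point of the power `n - m`.
  have h3 := (h n).congr (ht n) (ht m) (pathPrefix_eq_iff.mp h1) (pathPrefix_eq_iff.mp h2)
  have h4 := ((h m).symm.add h3).eq_zero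
  exact Subtype.ext (by omega)

/-! ### The finite-dimensional subalgebras of the crossed product -/

/-- The canonical linear map `C₀(Xₙ) → C(X) ⋊ ℤ`, `a ↦ a δₙ`. -/
def homogeneous (n : ℤ) : D.vershikAction.C₀ n →ₗ[ℂ] D.vershikAction.CrossedProduct where
  toFun a := PartialAction.CrossedProduct.of _ (PartialAction.AlgCrossedProduct.δ _ n a)
  map_add' a b := by rw [map_add, PartialAction.CrossedProduct.of_add]
  map_smul' c a := by rw [map_smul, PartialAction.CrossedProduct.of_smul]; rfl

/-- The bound holds in every `*`-representation, hence for the supremum that defines the norm. It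
turns uniform approximation of coefficients into approximation in the crossed product. -/
theorem norm_homogeneous_le {n : ℤ} (a : D.vershikAction.C₀ n) :
    ‖homogeneous n a‖ ≤ ‖(a : C(D.PathSpace, ℂ))‖ := by
  change ‖PartialAction.CrossedProduct.of _ _‖ ≤ _
  rw [PartialAction.CrossedProduct.norm_of]
  exact PartialAction.AlgCrossedProduct.norm_le _ fun B _ π =>
    PartialAction.AlgCrossedProduct.norm_apply_δ_le _ π n a

/-- The homogeneous elements with a coefficient of level `k`. -/
def levelSet (D : OrderedBratteliDiagram.{u, v}) (k : ℕ) : Set D.vershikAction.CrossedProduct :=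
  {c | ∃ n, ∃ a ∈ levelSubmodule (D := D) k n, homogeneous n a = c}

theorem levelSet_mono {k l : ℕ} (hkl : k ≤ l) : levelSet D k ⊆ levelSet D l := by
  rintro _ ⟨n, a, ha, rfl⟩
  exact ⟨n, a, levelSubmodule_mono hkl n ha, rfl⟩

/-- The C⋆-subalgebra of `C(X) ⋊ ℤ` spanned by the homogeneous elements of level `k`. -/
def levelSubalgebra (D : OrderedBratteliDiagram.{u, v}) (k : ℕ) :
    NonUnitalStarSubalgebra ℂ D.vershikAction.CrossedProduct :=
  { Submodule.span ℂ (levelSet D k) with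
    mul_mem' := by
      intro a b ha hb
      have h : a * b ∈ Submodule.span ℂ (levelSet D k) * Submodule.span ℂ (levelSet D k) :=
        Submodule.mul_mem_mul ha hb
      rw [Submodule.span_mul_span] at h
      refine Submodule.span_mono ?_ h
      rintro _ ⟨_, ⟨n, a, ha, rfl⟩, _, ⟨m, b, hb, rfl⟩, rfl⟩
      refine ⟨n + m, _, gmul_mem_levelSubmodule ha hb, ?_⟩
      change PartialAction.CrossedProduct.of _ _ =
        PartialAction.CrossedProduct.of _ _ * PartialAction.CrossedProduct.of _ _
      rw [← PartialAction.CrossedProduct.of_mul, PartialAction.AlgCrossedProduct.δ_mul_δ]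
    star_mem' := by
      intro a ha
      change star a ∈ Submodule.span ℂ (levelSet D k)
      induction ha using Submodule.span_induction with
      | mem c hc =>
        obtain ⟨n, a, ha, rfl⟩ := hc
        refine Submodule.subset_span ⟨-n, _, gstar_mem_levelSubmodule ha, ?_⟩
        change PartialAction.CrossedProduct.of _ _ = star (PartialAction.CrossedProduct.of _ _)
        rw [← PartialAction.CrossedProduct.of_star, PartialAction.AlgCrossedProduct.star_δ]
      | zero => rw [star_zero]; exact Submodule.zero_mem _
      | add a b _ _ ha hb => rw [star_add]; exact Submodule.add_mem _ ha hb
      | smul c a _ ha => rw [star_smul]; exact Submodule.smul_mem _ _ ha }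

theorem levelSubalgebra_mono : Monotone (levelSubalgebra D) :=
  fun _ _ hkl _ hc => Submodule.span_mono (levelSet_mono hkl) hc

theorem finiteDimensional_levelSubalgebra (k : ℕ) :
    FiniteDimensional ℂ (levelSubalgebra D k) := by
  let p : ℤ → Submodule ℂ D.vershikAction.CrossedProduct :=
    fun n => (levelSubmodule k n).map (homogeneous n)
  have hp : ∀ n, FiniteDimensional ℂ (p n) := fun n =>
    have := finiteDimensional_levelSubmodule (D := D) k n
    inferInstanceAs (FiniteDimensional ℂ ((levelSubmodule k n).map (homogeneous n)))
  have hle : Submodule.span ℂ (levelSet D k) ≤ (finite_powers (D := D) k).toFinset.sup p := by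
    rw [Submodule.span_le]
    rintro _ ⟨n, a, ha, rfl⟩
    by_cases hn : n ∈ (finite_powers (D := D) k).toFinset
    · exact Finset.le_sup (f := p) hn ⟨a, ha, rfl⟩
    -- A nonzero value of `a` would, by the support condition, exhibit `n` as one of the finitely
    -- many exponents.
    · have h0 : a = 0 := by
        refine Subtype.ext (ContinuousMap.ext fun y => ?_)
        by_contra hy
        obtain ⟨x, hx, ht⟩ := ha.2 y hy
        exact hn ((finite_powers k).mem_toFinset.mpr ⟨x, y, hx, ht⟩)
      rw [h0, map_zero]
      exact Submodule.zero_mem _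
  have := Submodule.finiteDimensional_finset_sup (finite_powers (D := D) k).toFinset p
  exact Submodule.finiteDimensional_of_le hle

/-! ### Density -/

/-- Every function in `C₀(Xₙ)` is a uniform limit of functions of finite level. -/
theorem exists_levelSubmodule_near {n : ℤ} (a : D.vershikAction.C₀ n) {ε : ℝ} (hε : 0 < ε) :
    ∃ k, ∃ b ∈ levelSubmodule (D := D) k n,
      ‖((a - b : D.vershikAction.C₀ n) : C(D.PathSpace, ℂ))‖ ≤ ε := by
  classical
  let f : C(D.PathSpace, ℂ) := a
  -- `W k` is the largest support allowed at level `k`; by locality (`hW`) it is a union of cylinder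
  -- sets.
  let W : ℕ → Set D.PathSpace := fun k => {y | ∃ x, PowerRel n x y ∧ SameTail k x y}
  have hW : ∀ k x y, SamePrefix k x y → x ∈ W k → y ∈ W k := by
    rintro k x y h ⟨x', hx', ht⟩
    obtain ⟨y', hy', _, ht'⟩ := hx'.symm.exists_of_samePrefix ht.symm h
    exact ⟨y', PowerRel.symm_iff.mp hy', ht'.symm⟩
  -- `U k` collects the points where level `k` is good enough: `f` varies by less than `ε` on the
  -- cylinder, and the cylinder is either inside the allowed support or a place where `f` is small.
  let U : ℕ → Set D.PathSpace := fun k => {x | (∀ y, SamePrefix k x y → ∀ z, SamePrefix k x z →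
    ‖f y - f z‖ < ε) ∧ (x ∈ W k ∨ ∀ y, SamePrefix k x y → ‖f y‖ < ε)}
  have hUo : ∀ k, IsOpen (U k) := by
    refine fun k => isOpen_of_samePrefix (k := k) ?_
    rintro x y h ⟨h1, h2⟩
    exact ⟨fun z hz w hw => h1 z (h.trans hz) w (h.trans hw),
      h2.imp (hW k x y h) fun h2 z hz => h2 z (h.trans hz)⟩
  have hUm : Monotone U := by
    rintro k l hkl x ⟨h1, h2⟩
    refine ⟨fun y hy z hz => h1 y (hy.mono hkl) z (hz.mono hkl), h2.imp ?_ ?_⟩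
    · rintro ⟨z, hz, ht⟩
      exact ⟨z, hz, ht.mono hkl⟩
    · exact fun h y hy => h y (hy.mono hkl)
  have hUc : Set.univ ⊆ ⋃ k, U k := by
    intro x _
    obtain ⟨k, hk⟩ := exists_samePrefix_subset
      (f.continuous.continuousAt.preimage_mem_nhds (Metric.ball_mem_nhds (f x) (half_pos hε)))
    have h1 : ∀ l, k ≤ l → ∀ y, SamePrefix l x y → ∀ z, SamePrefix l x z → ‖f y - f z‖ < ε := by
      intro l hl y hy z hz
      have h2 : dist (f y) (f x) < ε / 2 := hk y (hy.mono hl)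
      have h3 : dist (f z) (f x) < ε / 2 := hk z (hz.mono hl)
      rw [← dist_eq_norm]
      linarith [dist_triangle_right (f y) (f z) (f x)]
    -- In Xₙ some level admits `x` to the support; off Xₙ the function vanishes at `x`, so small
    -- variation makes it small on the whole cylinder.
    by_cases hx : x ∈ (D.vershikAction.map n).target
    · obtain ⟨m, hm⟩ := (PowerRel.of_mem_target hx).exists_sameTail
      exact Set.mem_iUnion.mpr ⟨max k m, h1 _ (le_max_left k m),
        Or.inl ⟨_, PowerRel.of_mem_target hx, hm.mono (le_max_right k m)⟩⟩
    · refine Set.mem_iUnion.mpr ⟨k, h1 k le_rfl, Or.inr fun y hy => ?_⟩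
      have h2 := h1 k le_rfl y hy x fun _ _ => rfl
      rwa [show f x = 0 from D.vershikAction.C₀_apply a hx, sub_zero] at h2
  obtain ⟨k, hk⟩ := isCompact_univ.elim_directed_cover U hUo hUc hUm.directed_le
  -- The approximant samples `f` at one path per prefix occurring in `W k`. The value `0` elsewhere
  -- secures both membership in C₀(Xₙ) and the support condition.
  let r : (∀ j : Fin k, D.E (j + 1)) → ℂ := fun p =>
    if h : ∃ x ∈ W k, pathPrefix k x = p then f h.choose else 0
  have hr : ∀ x ∈ W k, ∃ y, SamePrefix k x y ∧ r (pathPrefix k x) = f y := by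
    intro x hx
    have h : ∃ y ∈ W k, pathPrefix k y = pathPrefix k x := ⟨x, hx, rfl⟩
    exact ⟨h.choose, (pathPrefix_eq_iff.mp h.choose_spec.2).symm, dif_pos h⟩
  have hr0 : ∀ x ∉ W k, r (pathPrefix k x) = 0 := by
    intro x hx
    refine dif_neg ?_
    rintro ⟨y, hy, hyx⟩
    exact hx (hW k y x (pathPrefix_eq_iff.mp hyx) hy)
  let g : C(D.PathSpace, ℂ) :=
    ⟨r ∘ pathPrefix k, (continuous_of_discreteTopology (f := r)).comp (continuous_pathPrefix k)⟩
  refine ⟨k, ⟨g, fun x hx => hr0 x ?_⟩, ⟨fun x y h => ?_, fun y hy => ?_⟩, ?_⟩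
  · rintro ⟨y, hy, _⟩
    exact hx hy.mem_target
  · exact congrArg r (pathPrefix_eq_iff.mpr h)
  · by_contra h
    exact hy (hr0 y h)
  · refine (ContinuousMap.norm_le _ hε.le).mpr fun x => ?_
    obtain ⟨h1, h2⟩ := hk (Set.mem_univ x)
    change ‖f x - r (pathPrefix k x)‖ ≤ ε
    by_cases hx : x ∈ W k
    · obtain ⟨y, hy, hry⟩ := hr x hx
      rw [hry]
      exact (h1 x (fun _ _ => rfl) y hy).le
    · rw [hr0 x hx, sub_zero]
      exact (h2.resolve_left hx x fun _ _ => rfl).le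

/-- The closure of the union is a linear subspace, so it contains the image of the algebraic crossed
product as soon as it contains every a δₙ; that image is dense in the completion. -/
theorem dense_levelSubalgebra :
    Dense (⋃ k, (levelSubalgebra D k : Set D.vershikAction.CrossedProduct)) := by
  have hdir : Directed (· ≤ ·) fun k => Submodule.span ℂ (levelSet D k) :=
    Monotone.directed_le fun _ _ hkl => Submodule.span_mono (levelSet_mono hkl)
  -- The union of a chain of subspaces is their supremum, which makes sums available in the closure.
  have hunion : (⋃ k, (levelSubalgebra D k : Set D.vershikAction.CrossedProduct)) =
      ((⨆ k, Submodule.span ℂ (levelSet D k) : Submodule ℂ D.vershikAction.CrossedProduct) :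
        Set D.vershikAction.CrossedProduct) :=
    (Submodule.coe_iSup_of_directed _ hdir).symm
  rw [hunion]
  set M : Submodule ℂ D.vershikAction.CrossedProduct := ⨆ k, Submodule.span ℂ (levelSet D k)
  have hof : ∀ c, PartialAction.CrossedProduct.of _ c ∈ M.topologicalClosure := by
    intro c
    induction c using PartialAction.AlgCrossedProduct.induction with
    | zero =>
      change (UniformSpace.Completion.coe' (0 : D.vershikAction.AlgCrossedProduct)) ∈ _
      rw [UniformSpace.Completion.coe_zero]
      exact Submodule.zero_mem _
    | add a b ha hb =>
      rw [PartialAction.CrossedProduct.of_add]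
      exact Submodule.add_mem _ ha hb
    | δ n a =>
      refine Metric.mem_closure_iff.mpr fun ε hε => ?_
      obtain ⟨k, b, hb, hab⟩ := exists_levelSubmodule_near a (half_pos hε)
      refine ⟨homogeneous n b, Submodule.mem_iSup_of_mem k
        (Submodule.subset_span ⟨n, b, hb, rfl⟩), ?_⟩
      change dist (homogeneous n a) (homogeneous n b) < ε
      rw [dist_eq_norm, ← map_sub]
      exact ((norm_homogeneous_le _).trans hab).trans_lt (half_lt_self hε)
  exact fun c => closure_minimal (Set.range_subset_iff.mpr hof) isClosed_closure
    (PartialAction.CrossedProduct.denseRange_of _ c)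

/-- The partial crossed product of the Vershik map of an ordered Bratteli diagram is an AF algebra,
even if the diagram is not stationary. -/
theorem isAFAlgebra_crossedProduct (D : OrderedBratteliDiagram.{u, v}) :
    IsAFAlgebra D.vershikAction.CrossedProduct :=
  ⟨levelSubalgebra D, levelSubalgebra_mono, finiteDimensional_levelSubalgebra,
    dense_levelSubalgebra⟩

end OrderedBratteliDiagram

end

theorem mainTheorem2 (D : OrderedBratteliDiagram.{u, v}) (hD : D.IsStationary) :
    IsAFAlgebra D.vershikAction.CrossedProduct := by
  exact D.isAFAlgebra_crossedProduct
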